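/- Let $\mathbf F_q$ be a finite field with $q$ elements and characteristic $p$, and let $a=|\mathrm{Aut}(\mathbf F_q)|$ be the number of its field automorphisms. A linear $q$-ary code of length $n$ is a linear subspace (of any dimension) of $\mathbf F_q^n$. Two such codes are called equivalent under - $(\mathfrak S)$, permutation equivalence, if one is mapped onto the other by a permutation of the coordinates; - $(\mathfrak M)$, monomial equivalence, if one is mapped onto the other by a permutation of the coordinates followed by multiplication of each coordinate by a nonzero scalar (which may depend on the coordinate); - $(\Gamma)$, semilinear monomial equivalence, if one is mapped onto the other by a map $x\mapsto (d_i\,\tau(x_{\sigma(i)}))_{1\le i\le n}$ with $\sigma$ a permutation of $\{1,\dots,n\}$, $d_i\in\mathbf F_q^\times$ and $\tau\in\mathrm{Aut}(\mathbf F_q)$. Let $N_{n,q}^{\mathfrak S}$, $N_{n,q}^{\mathfrak M}$, $N_{n,q}^{\Gamma}$ be the numbers of equivalence classes of linear $q$-ary codes of length $n$ under these three equivalences. For a permutation $\pi$ in the symmetric group $\mathfrak S_n$ let $\mathrm{des}(\pi)=|\{i : 1\le i<n,\ \pi(i)>\pi(i+1)\}|$ and $\mathrm{inv}(\pi)=|\{(i,j):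 i<j,\ \pi(i)>\pi(j)\}|$. Then $a=\log_p(q)$ and, as $q$ is fixed and $n\to\infty$, $$N_{n,q}^{\mathfrak S}\sim\frac1{n!}\sum_{\substack{\pi\in\mathfrak S_n\\ \mathrm{des}(\pi)\le1}}\binom{n+1-\mathrm{des}(\pi)}{n}q^{\mathrm{inv}(\pi)},$$ $$N_{n,q}^{\mathfrak M}\sim\frac1{n!\,(q-1)^{n-1}}\sum_{\substack{\pi\in\mathfrak S_n\\ \mathrm{des}(\pi)\le1}}\binom{n+1-\mathrm{des}(\pi)}{n}q^{\mathrm{inv}(\pi)},$$ $$N_{n,q}^{\Gamma}\sim\frac1{n!\,(q-1)^{n-1}\,a}\sum_{\substack{\pi\in\mathfrak S_n\\ \mathrm{des}(\pi)\le1}}\binom{n+1-\mathrm{des}(\pi)}{n}q^{\mathrm{inv}(\pi)},$$ where $f(n)\sim g(n)$ means $\lim_{n\to\infty}f(n)/g(n)=1$. -/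

import Mathlib

open scoped Nat
open Filter Asymptotics

/-- The descent set `{i : π(i) > π(i+1)}` of a permutation of `n` letters. -/
def descentSet {n : ℕ} (π : Equiv.Perm (Fin n)) : Finset (Fin n) :=
  {i | ∃ j : Fin n, (j : ℕ) = i + 1 ∧ π j < π i}

/-- The number of descents. -/
def des {n : ℕ} (π : Equiv.Perm (Fin n)) : ℕ :=
  (descentSet π).card

/-- The number of inversions, i.e. of pairs `i < j` with `π(i) > π(j)`. -/
def inv {n : ℕ} (π : Equiv.Perm (Fin n)) : ℕ :=
  Finset.card {ij : Fin n × Fin n | ij.1 < ij.2 ∧ π ij.2 < π ij.1}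


section Codes

/-- A linear code of length `n` over `F`: a subspace of `Fⁿ`, of any dimension. -/
abbrev LinCode (F : Type*) [Field F] (n : ℕ) : Type _ := Submodule F (Fin n → F)

variable {F : Type*} [Field F] {n : ℕ}

/-- Permutation equivalence: some permutation of the coordinates maps `C` onto `D`. -/
def PermEquivalent (C D : LinCode F n) : Prop :=
  ∃ σ : Equiv.Perm (Fin n),
    (fun (x : Fin n → F) i => x (σ i)) '' (C : Set (Fin n → F)) = (D : Set (Fin n → F))

/-- Monomial equivalence: some permutation of the coordinates, followed by a multiplication of
each coordinate by a nonzero scalar, maps `C` onto `D`. -/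
def MonomialEquivalent (C D : LinCode F n) : Prop :=
  ∃ (σ : Equiv.Perm (Fin n)) (d : Fin n → Fˣ),
    (fun (x : Fin n → F) i => (d i : F) * x (σ i)) '' (C : Set (Fin n → F)) =
      (D : Set (Fin n → F))

/-- Semilinear monomial equivalence: as monomial equivalence, but in addition an automorphism
of the field `F` may be applied to all coordinates at once. -/
def SemilinearEquivalent (C D : LinCode F n) : Prop :=
  ∃ (σ : Equiv.Perm (Fin n)) (d : Fin n → Fˣ) (τ : F ≃+* F),
    (fun (x : Fin n → F) i => (d i : F) * τ (x (σ i))) '' (C : Set (Fin n → F)) =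
      (D : Set (Fin n → F))

theorem permEquivalent_equivalence : Equivalence (PermEquivalent (F := F) (n := n)) where
  refl C := ⟨1, by simp⟩
  symm := by
    rintro C D ⟨σ, h⟩
    refine ⟨σ⁻¹, ?_⟩
    rw [← h, Set.image_image]
    simp
  trans := by
    rintro C D E ⟨σ, h⟩ ⟨σ', h'⟩
    refine ⟨σ * σ', ?_⟩
    rw [← h', ← h, Set.image_image]
    simp

theorem monomialEquivalent_equivalence :
    Equivalence (MonomialEquivalent (F := F) (n := n)) where
  refl C := ⟨1, 1, by simp⟩
  symm := by
    rintro C D ⟨σ, d, h⟩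
    refine ⟨σ⁻¹, fun i => (d (σ⁻¹ i))⁻¹, ?_⟩
    rw [← h, Set.image_image]
    simp
  trans := by
    rintro C D E ⟨σ, d, h⟩ ⟨σ', d', h'⟩
    refine ⟨σ * σ', fun i => d' i * d (σ' i), ?_⟩
    rw [← h', ← h, Set.image_image]
    simp [mul_assoc]

theorem semilinearEquivalent_equivalence :
    Equivalence (SemilinearEquivalent (F := F) (n := n)) where
  refl C := ⟨1, 1, RingEquiv.refl F, by simp⟩
  symm := by
    rintro C D ⟨σ, d, τ, h⟩
    refine ⟨σ⁻¹, fun i => Units.map (τ.symm : F →* F) (d (σ⁻¹ i))⁻¹, τ.symm, ?_⟩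
    rw [← h, Set.image_image]
    simp
  trans := by
    rintro C D E ⟨σ, d, τ, h⟩ ⟨σ', d', τ', h'⟩
    refine ⟨σ * σ', fun i => d' i * Units.map (τ' : F →* F) (d (σ' i)), τ.trans τ', ?_⟩
    rw [← h', ← h, Set.image_image]
    simp [mul_assoc]

end Codes

/-- The number of codes of length `n` over `F` up to permutation equivalence. -/
noncomputable def numPerm (F : Type*) [Field F] (n : ℕ) : ℕ :=
  Nat.card (Quotient (⟨PermEquivalent, permEquivalent_equivalence⟩ : Setoid (LinCode F n)))

/-- The number of codes of length `n` over `F` up to monomial equivalence. -/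
noncomputable def numMonomial (F : Type*) [Field F] (n : ℕ) : ℕ :=
  Nat.card
    (Quotient (⟨MonomialEquivalent, monomialEquivalent_equivalence⟩ : Setoid (LinCode F n)))

/-- The number of codes of length `n` over `F` up to semilinear monomial equivalence. -/
noncomputable def numSemilinear (F : Type*) [Field F] (n : ℕ) : ℕ :=
  Nat.card
    (Quotient (⟨SemilinearEquivalent, semilinearEquivalent_equivalence⟩ : Setoid (LinCode F n)))

/-! The three numbers count the orbits of three subgroups of the finite group of semilinear monomial
maps acting on the set of all codes. Let `G` be the number of codes of length `n`. By Burnside, the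
number of orbits of `H` times `|H|` is the total number of codes fixed by the elements of `H`. A
scalar fixes every code, and `H` contains `1` or `q - 1` scalars, so the claim is that all
non-scalar maps together fix only `o(G)` codes (`tendsto_numFixedNonscalar_div`). The sum over
permutations is `G` itself (`sum_des_le_one`): a permutation with at most one descent, with a cut
position, encodes a subset, and inversions give the weight in the Gaussian binomial coefficients.

Up to a polynomial factor `G` is `q^(n²/4)`, while the group has only `q^(O(n log n))` elements. A
fixed code is an invariant subspace, and two bounds apply to these. If the field automorphism is
nontrivial, or every eigenspace has dimension at most `n/4`, then most vectors raise the dimension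
of an invariant subspace by two. About `k/2` vectors plus a correction then generate an invariant
subspace of dimension `k`, which bounds their number by `q^(cn²)` with `c < 1/4`
(`card_invariant_le_pow`). If a linear `p` has an eigenspace of dimension `n - r > n/4`, then `p`
fixes at most as many codes as there are pairs of codes of lengths `r` and `n - r`
(`card_invariant_le_mul`). This saves about `q^(r(n-r)/2)`. Such a `p` differs from a scalar in at
most `2r` coordinates (`card_moved_le`), so there are only `(n²q)^(2r)` of them for each scalar. -/

/-- The number of `k`-dimensional subspaces of `Fⁿ`. -/
noncomputable def numSubspaces (F : Type*) [Field F] (n k : ℕ) : ℕ :=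
  Nat.card {W : LinCode F n // Module.finrank F W = k}

/-! ### Gaussian binomial coefficients and the size `q^(n²/4)` of the number of codes. -/

section SubspaceCounts

open Module

variable {F : Type*} [Field F]

theorem card_submodule_finrank_eq {V : Type*} [AddCommGroup V] [Module F V]
    [FiniteDimensional F V] (k : ℕ) :
    Nat.card {W : Submodule F V // finrank F W = k} = numSubspaces F (finrank F V) k := by
  have e : V ≃ₗ[F] (Fin (finrank F V) → F) := LinearEquiv.ofFinrankEq _ _ (by simp)
  refine Nat.card_congr ((Submodule.orderIsoMapComap e).toEquiv.subtypeEquiv fun W => ?_)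
  exact Eq.congr_left (LinearEquiv.finrank_map_eq e W).symm

theorem card_submodule_eq {V : Type*} [AddCommGroup V] [Module F V]
    [FiniteDimensional F V] :
    Nat.card (Submodule F V) = Nat.card (LinCode F (finrank F V)) := by
  have e : V ≃ₗ[F] (Fin (finrank F V) → F) := LinearEquiv.ofFinrankEq _ _ (by simp)
  exact Nat.card_congr (Submodule.orderIsoMapComap e).toEquiv

theorem numSubspaces_zero_right (n : ℕ) : numSubspaces F n 0 = 1 := by
  have : Unique {W : LinCode F n // finrank F W = 0} :=
    ⟨⟨⟨⊥, by simp⟩⟩, fun W => Subtype.ext (Submodule.finrank_eq_zero.1 W.2)⟩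
  exact Nat.card_unique

theorem numSubspaces_eq_zero {n k : ℕ} (h : n < k) : numSubspaces F n k = 0 := by
  have : IsEmpty {W : LinCode F n // finrank F W = k} := by
    refine ⟨fun W => ?_⟩
    have := Submodule.finrank_le W.1
    have := W.2
    simp at *; omega
  exact Nat.card_of_isEmpty

/-- Vectors of `W` on which a functional takes the value `1` form a coset of the kernel. -/
theorem card_level_one {V : Type*} [AddCommGroup V] [Module F V] [FiniteDimensional F V]
    (f : V →ₗ[F] F) {W : Submodule F V} (hW : ¬ W ≤ LinearMap.ker f) :
    Nat.card {v // v ∈ W ∧ f v = 1} =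
      Nat.card F ^ finrank F (W ⊓ LinearMap.ker f : Submodule F V) := by
  obtain ⟨w, hw, hf⟩ := SetLike.not_le_iff_exists.1 hW
  have hf : f w ≠ 0 := hf
  have hu : f ((f w)⁻¹ • w) = 1 := by simp [hf]
  set u := (f w)⁻¹ • w
  have huW : u ∈ W := W.smul_mem _ hw
  rw [← natCard_eq_pow_finrank]
  refine Nat.card_congr
    { toFun := fun v => ⟨v.1 - u, W.sub_mem v.2.1 huW, by simp [v.2.2, hu]⟩
      invFun := fun v => ⟨v.1 + u, W.add_mem v.2.1 huW, ?_⟩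
      left_inv := fun v => by simp
      right_inv := fun v => by simp }
  have : f v.1 = 0 := v.2.2
  simp [this, hu]

theorem finrank_inf_ker_add_one {V : Type*} [AddCommGroup V] [Module F V]
    [FiniteDimensional F V] (f : V →ₗ[F] F) {W : Submodule F V}
    (hW : ¬ W ≤ LinearMap.ker f) :
    finrank F (W ⊓ LinearMap.ker f : Submodule F V) + 1 = finrank F W := by
  have hr : finrank F (LinearMap.range (f.comp W.subtype)) = 1 := by
    have : LinearMap.range (f.comp W.subtype) = ⊤ := by
      rw [LinearMap.range_eq_top]
      refine LinearMap.surjective fun h => hW fun w hw => ?_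
      exact LinearMap.congr_fun h ⟨w, hw⟩
    rw [this]; simp
  have hk : finrank F (LinearMap.ker (f.comp W.subtype)) =
      finrank F (W ⊓ LinearMap.ker f : Submodule F V) := by
    rw [LinearMap.ker_comp, ← Submodule.map_comap_subtype]
    exact (LinearEquiv.finrank_eq (Submodule.equivMapOfInjective _ W.subtype_injective _))
  have := (f.comp W.subtype).finrank_range_add_finrank_ker
  omega

theorem card_submodule_le_finrank_eq {V : Type*} [AddCommGroup V] [Module F V]
    [FiniteDimensional F V] (H : Submodule F V) (k : ℕ) :
    Nat.card {W : Submodule F V // W ≤ H ∧ finrank F W = k} =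
      numSubspaces F (finrank F H) k := by
  rw [← card_submodule_finrank_eq (V := H)]
  symm
  refine (Nat.card_congr ((Submodule.mapIic H).toEquiv.subtypeEquiv
    (q := fun W : {W : Submodule F V // W ≤ H} => finrank F W.1 = k) fun W => ?_)).trans
    (Nat.card_congr (Equiv.subtypeSubtypeEquivSubtypeInter (fun W => W ≤ H)
      fun W => finrank F W = k))
  have : finrank F (W.map H.subtype) = finrank F W :=
    (LinearEquiv.finrank_eq (Submodule.equivMapOfInjective _ H.subtype_injective _)).symm
  exact Eq.congr_left this.symm

variable [Finite F]

theorem card_linCode_eq_sum (n : ℕ) :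
    Nat.card (LinCode F n) = ∑ k ∈ Finset.range (n + 1), numSubspaces F n k := by
  classical
  have : Fintype (LinCode F n) := Fintype.ofFinite _
  rw [Nat.card_eq_fintype_card, ← Finset.card_univ,
    Finset.card_eq_sum_card_fiberwise (f := fun W : LinCode F n => finrank F W)
      (t := Finset.range (n + 1))]
  · refine Finset.sum_congr rfl fun k _ => ?_
    rw [numSubspaces, Nat.card_eq_fintype_card, Fintype.card_subtype]
  · intro W _
    have := Submodule.finrank_le W
    simp at this
    simp; omega

/-- Pairs `(W, v)` with `v ∈ W` and `f v = 1` are counted twice. Such a pair is the same as the pair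
`(W ⊓ ker f, v)`, since `W` is the sum of `W ⊓ ker f` and the line of `v`; and each `W` contains
`q^k` such vectors. -/
theorem card_not_le_ker {V : Type*} [AddCommGroup V] [Module F V] [FiniteDimensional F V]
    (f : V →ₗ[F] F) (hf : f ≠ 0) {n : ℕ} (hn : finrank F V = n + 1) (k : ℕ) :
    Nat.card {W : Submodule F V // ¬ W ≤ LinearMap.ker f ∧ finrank F W = k + 1} *
      Nat.card F ^ k = numSubspaces F n k * Nat.card F ^ n := by
  have : Finite V := Module.finite_of_finite F
  have htop : ¬ (⊤ : Submodule F V) ≤ LinearMap.ker f := fun h =>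
    hf (LinearMap.ext fun v => h trivial)
  have hH : finrank F (LinearMap.ker f) = n := by
    have := finrank_inf_ker_add_one f htop
    rw [top_inf_eq, finrank_top] at this
    omega
  have hV : Nat.card {v // f v = 1} = Nat.card F ^ n := by
    have := card_level_one f htop
    rw [top_inf_eq, hH] at this
    simpa using this
  have hsplit : ∀ {W : Submodule F V} {v : V}, v ∈ W → f v = 1 →
      (W ⊓ LinearMap.ker f) ⊔ Submodule.span F {v} = W := by
    intro W v hv h1
    refine le_antisymm (sup_le inf_le_left (by simpa using hv)) fun w hw => ?_
    rw [Submodule.mem_sup]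
    refine ⟨w - f w • v, ⟨W.sub_mem hw (W.smul_mem _ hv), by simp [h1]⟩, f w • v,
      Submodule.smul_mem _ _ (Submodule.mem_span_singleton_self v), by simp⟩
  have hinf : ∀ {W' : Submodule F V} {v : V}, W' ≤ LinearMap.ker f → f v = 1 →
      (W' ⊔ Submodule.span F {v}) ⊓ LinearMap.ker f = W' := by
    intro W' v hW' h1
    refine le_antisymm ?_ (le_inf le_sup_left hW')
    rintro x ⟨hx, hx0⟩
    obtain ⟨y, hy, z, hz, rfl⟩ := Submodule.mem_sup.1 hx
    obtain ⟨c, rfl⟩ := Submodule.mem_span_singleton.1 hz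
    have hy0 : f y = 0 := hW' hy
    have hx0 : f (y + c • v) = 0 := hx0
    have : c = 0 := by simpa [hy0, h1] using hx0
    simpa [this] using hy
  have hnot : ∀ {W : Submodule F V} {v : V}, v ∈ W → f v = 1 → ¬ W ≤ LinearMap.ker f := by
    intro W v hv h1 h
    have : f v = 0 := h hv
    simp [h1] at this
  let e : (Σ W : {W : Submodule F V // ¬ W ≤ LinearMap.ker f ∧ finrank F W = k + 1},
        {v // v ∈ W.1 ∧ f v = 1}) ≃
      {W : Submodule F V // W ≤ LinearMap.ker f ∧ finrank F W = k} × {v // f v = 1} :=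
    { toFun := fun x => (⟨x.1.1 ⊓ LinearMap.ker f, inf_le_right, by
          have := finrank_inf_ker_add_one f x.1.2.1
          have := x.1.2.2
          omega⟩, ⟨x.2.1, x.2.2.2⟩)
      invFun := fun y => ⟨⟨y.1.1 ⊔ Submodule.span F {y.2.1},
          hnot (le_sup_right (a := y.1.1) (Submodule.mem_span_singleton_self y.2.1)) y.2.2, by
            rw [← finrank_inf_ker_add_one f (hnot (le_sup_right (a := y.1.1)
              (Submodule.mem_span_singleton_self y.2.1)) y.2.2), hinf y.1.2.1 y.2.2, y.1.2.2]⟩,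
          ⟨y.2.1, le_sup_right (a := y.1.1) (Submodule.mem_span_singleton_self y.2.1), y.2.2⟩⟩
      left_inv := by
        rintro ⟨⟨W, h1, h2⟩, ⟨v, h3, h4⟩⟩
        exact Sigma.subtype_ext (Subtype.ext (hsplit h3 h4)) rfl
      right_inv := by
        rintro ⟨⟨W, h1, h2⟩, ⟨v, h3⟩⟩
        exact Prod.ext (Subtype.ext (hinf h1 h3)) rfl }
  have key := Nat.card_congr e
  rw [Nat.card_prod, hV, card_submodule_le_finrank_eq, hH] at key
  rw [← key]
  have : Fintype {W : Submodule F V // ¬ W ≤ LinearMap.ker f ∧ finrank F W = k + 1} :=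
    Fintype.ofFinite _
  rw [Nat.card_sigma, Nat.card_eq_fintype_card]
  rw [Finset.sum_congr rfl (g := fun _ => Nat.card F ^ k)]
  · simp
  · rintro W -
    rw [card_level_one f W.2.1]
    have := finrank_inf_ker_add_one f W.2.1
    have := W.2.2
    congr 1; omega

/-- Pascal's rule for the Gaussian binomial coefficients. -/
theorem numSubspaces_succ_succ {n k : ℕ} (h : k ≤ n) :
    numSubspaces F (n + 1) (k + 1) =
      numSubspaces F n (k + 1) + Nat.card F ^ (n - k) * numSubspaces F n k := by
  classical
  let f : (Fin (n + 1) → F) →ₗ[F] F := LinearMap.proj 0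
  have hf : f ≠ 0 := fun h => by simpa [f] using LinearMap.congr_fun h 1
  have hker : finrank F (LinearMap.ker f) = n := by
    have := finrank_inf_ker_add_one f (W := ⊤) fun h => hf (LinearMap.ext fun v => h trivial)
    rw [top_inf_eq, finrank_top] at this
    simpa using this
  have h1 := card_not_le_ker f hf (n := n) (by simp) k
  have h2 := card_submodule_le_finrank_eq (LinearMap.ker f) (k + 1)
  rw [hker] at h2
  have hq : 0 < Nat.card F ^ k := pow_pos Nat.card_pos _
  have h3 : Nat.card {W : LinCode F (n + 1) //
      ¬ W ≤ LinearMap.ker f ∧ finrank F W = k + 1} =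
      Nat.card F ^ (n - k) * numSubspaces F n k := by
    refine Nat.eq_of_mul_eq_mul_right hq ?_
    rw [h1, mul_comm, mul_right_comm, ← pow_add, Nat.sub_add_cancel h]
  rw [← h2, ← h3, numSubspaces]
  have : Fintype (LinCode F (n + 1)) := Fintype.ofFinite _
  simp only [Nat.card_eq_fintype_card, Fintype.card_subtype]
  rw [← Finset.card_filter_add_card_filter_not (fun W => W ≤ LinearMap.ker f)]
  simp only [Finset.filter_filter, and_comm]

theorem numSubspaces_le (n k : ℕ) (h : k ≤ n) :
    numSubspaces F n k ≤ (k + 1) * Nat.card F ^ (k * (n - k)) := by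
  have hq : 2 ≤ Nat.card F := Finite.one_lt_card
  induction n generalizing k with
  | zero => obtain rfl : k = 0 := by omega
            simp [numSubspaces_zero_right]
  | succ n ih =>
    cases k with
    | zero => simp [numSubspaces_zero_right]
    | succ k =>
      rw [numSubspaces_succ_succ (by omega)]
      set q := Nat.card F
      -- In Pascal's rule the first term has an exponent smaller by `k + 1` than the target, and
      -- this surplus power absorbs its factor `k + 2`; only the second term contributes to the
      -- linear factor.
      have hk : k + 2 ≤ q ^ (k + 1) :=
        (Nat.succ_le_of_lt (Nat.lt_two_pow_self (n := k + 1))).trans (Nat.pow_le_pow_left hq _)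
      have e1 : (k + 1) * (n + 1 - (k + 1)) = (n - k) + k * (n - k) := by
        rw [Nat.add_sub_add_right]; ring
      have h1 : numSubspaces F n (k + 1) ≤ q ^ ((n - k) + k * (n - k)) := by
        rcases Nat.lt_or_ge n (k + 1) with h' | h'
        · rw [numSubspaces_eq_zero h']; exact Nat.zero_le _
        · refine (ih _ h').trans ((Nat.mul_le_mul_right _ hk).trans_eq ?_)
          rw [← pow_add]
          congr 1
          obtain ⟨m, rfl⟩ := Nat.exists_eq_add_of_le h'
          rw [show k + 1 + m - (k + 1) = m by omega, show k + 1 + m - k = m + 1 by omega]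
          ring
      have h2 := Nat.mul_le_mul_left (q ^ (n - k)) (ih k (by omega))
      rw [e1]
      calc _ ≤ q ^ ((n - k) + k * (n - k)) + q ^ (n - k) * ((k + 1) * q ^ (k * (n - k))) :=
            add_le_add h1 h2
        _ = _ := by rw [pow_add]; ring

theorem pow_le_numSubspaces (n k : ℕ) (h : k ≤ n) :
    Nat.card F ^ (k * (n - k)) ≤ numSubspaces F n k := by
  induction n generalizing k with
  | zero => obtain rfl : k = 0 := by omega
            simp [numSubspaces_zero_right]
  | succ n ih =>
    cases k with
    | zero => simp [numSubspaces_zero_right]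
    | succ k =>
      rw [numSubspaces_succ_succ (by omega)]
      refine le_trans ?_ (Nat.le_add_left _ _)
      refine le_trans (le_of_eq ?_) (Nat.mul_le_mul_left _ (ih k (by omega)))
      rw [← pow_add, Nat.add_sub_add_right]
      congr 1; ring

theorem mul_sub_le_sq_div_four (n k : ℕ) (h : k ≤ n) : k * (n - k) ≤ n ^ 2 / 4 := by
  rw [Nat.le_div_iff_mul_le (by norm_num)]
  obtain ⟨m, rfl⟩ := Nat.exists_eq_add_of_le h
  rw [Nat.add_sub_cancel_left]
  zify
  nlinarith [sq_nonneg ((k : ℤ) - m)]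

theorem card_linCode_le (n : ℕ) :
    Nat.card (LinCode F n) ≤ (n + 1) ^ 2 * Nat.card F ^ (n ^ 2 / 4) := by
  rw [card_linCode_eq_sum]
  refine (Finset.sum_le_card_nsmul _ _ ((n + 1) * Nat.card F ^ (n ^ 2 / 4)) ?_).trans_eq ?_
  · intro k hk
    have hk : k ≤ n := by simp at hk; omega
    exact (numSubspaces_le n k hk).trans (Nat.mul_le_mul (by omega)
      (Nat.pow_le_pow_right Nat.card_pos (mul_sub_le_sq_div_four n k hk)))
  · simp; ring

theorem pow_le_card_linCode (n : ℕ) :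
    Nat.card F ^ (n ^ 2 / 4) ≤ Nat.card (LinCode F n) := by
  rw [card_linCode_eq_sum]
  have h := pow_le_numSubspaces (F := F) n (n / 2) (Nat.div_le_self _ _)
  have e : n / 2 * (n - n / 2) = n ^ 2 / 4 := by
    rcases Nat.even_or_odd' n with ⟨m, rfl | rfl⟩
    · rw [show 2 * m / 2 = m by omega, show 2 * m - m = m by omega,
        show (2 * m) ^ 2 = m * m * 4 by ring, Nat.mul_div_cancel _ (by norm_num)]
    · rw [show (2 * m + 1) / 2 = m by omega, show 2 * m + 1 - m = m + 1 by omega,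
        show (2 * m + 1) ^ 2 = m * (m + 1) * 4 + 1 by ring]
      omega
  rw [e] at h
  exact h.trans (Finset.single_le_sum (f := fun k => numSubspaces F n k)
    (fun _ _ => Nat.zero_le _) (by simp; omega))

end SubspaceCounts
-- Permutations with at most one descent and the count of all codes.
/-- The number of pairs `x < y` with `y ∈ S` and `x ∉ S`. -/
def setWeight (S : Finset ℕ) : ℕ := ∑ y ∈ S, (Finset.range y \ S).card

theorem setWeight_insert {n : ℕ} {S : Finset ℕ} (hS : S ⊆ Finset.range n) :
    setWeight (insert n S) = setWeight S + (n - S.card) := by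
  have hn : n ∉ S := fun h => by simpa using hS h
  rw [setWeight, Finset.sum_insert hn, add_comm]
  congr 1
  · refine Finset.sum_congr rfl fun y hy => ?_
    have hy : y < n := by simpa using hS hy
    rw [Finset.sdiff_insert_of_notMem (by simp; omega)]
  · rw [Finset.sdiff_insert_of_notMem (by simp), Finset.card_sdiff_of_subset hS,
      Finset.card_range]

/-- Both sides satisfy the same Pascal rule: the sets are split by whether they contain the largest
element, which adds `n - k` to the weight. -/
theorem sum_pow_setWeight (F : Type*) [Field F] [Finite F] (n k : ℕ) :
    ∑ S ∈ (Finset.range n).powersetCard k, Nat.card F ^ setWeight S = numSubspaces F n k := by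
  induction n generalizing k with
  | zero =>
    cases k with
    | zero => simp [numSubspaces_zero_right, setWeight]
    | succ k => simp [numSubspaces_eq_zero]
  | succ n ih =>
    cases k with
    | zero => simp [numSubspaces_zero_right, setWeight]
    | succ k =>
      rcases Nat.lt_or_ge n k with h | h
      · rw [numSubspaces_eq_zero (by omega), Finset.powersetCard_eq_empty.2 (by simp; omega),
          Finset.sum_empty]
      rw [numSubspaces_succ_succ h, Finset.range_add_one,
        Finset.powersetCard_succ_insert (by simp), Finset.sum_union, ih, Finset.sum_image]
      · rw [← ih k, Finset.mul_sum]
        congr 1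
        refine Finset.sum_congr rfl fun S hS => ?_
        rw [Finset.mem_powersetCard] at hS
        rw [setWeight_insert hS.1, hS.2, pow_add, mul_comm]
      · intro S hS T hT h
        have hS := (Finset.mem_powersetCard.1 hS).1
        have hT := (Finset.mem_powersetCard.1 hT).1
        rw [← Finset.erase_insert (a := n) (s := S) fun h => by simpa using hS h, h,
          Finset.erase_insert fun h => by simpa using hT h]
      · rw [Finset.disjoint_left]
        intro S hS hT
        obtain ⟨T, -, rfl⟩ := Finset.mem_image.1 hT
        simpa using (Finset.mem_powersetCard.1 hS).1 (Finset.mem_insert_self n T)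

/-- `π` is increasing on the first `k` positions and on the remaining ones. -/
def IsGrassmannian {n : ℕ} (k : ℕ) (π : Equiv.Perm (Fin n)) : Prop :=
  ∀ i j : Fin n, i < j → ((j : ℕ) < k ∨ k ≤ (i : ℕ)) → π i < π j

theorem isGrassmannian_iff {n k : ℕ} {π : Equiv.Perm (Fin n)} :
    IsGrassmannian k π ↔ ∀ i ∈ descentSet π, (i : ℕ) + 1 = k := by
  simp only [descentSet, Finset.mem_filter, Finset.mem_univ, true_and]
  constructor
  · rintro h i ⟨j, hj, hd⟩
    by_contra hk
    exact absurd (h i j (Fin.lt_def.2 (by omega)) (by omega)) hd.not_gt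
  · intro h i j hij hk
    have key : ∀ m : ℕ, (i : ℕ) + 1 ≤ m → ∀ hm : m < n, (m < k ∨ k ≤ (i : ℕ)) →
        π i < π ⟨m, hm⟩ := by
      intro m hm
      induction m, hm using Nat.le_induction with
      | base =>
        intro hm hk
        refine lt_of_le_of_ne (not_lt.1 fun hlt => ?_) (π.injective.ne ?_)
        · have := h i ⟨_, rfl, hlt⟩
          omega
        · exact Fin.ne_of_val_ne (by simp)
      | succ m hm ih =>
        intro hm' hk
        refine (ih (by omega) (by omega)).trans (lt_of_le_of_ne (not_lt.1 fun hlt => ?_)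
          (π.injective.ne ?_))
        · have := h ⟨m, by omega⟩ ⟨⟨m + 1, hm'⟩, rfl, hlt⟩
          simp only at this
          omega
        · exact Fin.ne_of_val_ne (by simp)
    exact key j hij j.2 hk

-- The binomial coefficient counts the admissible cut positions `k`: all `n + 1` of them if there is
-- no descent, exactly one if there is one descent.
open Classical in
theorem card_isGrassmannian {n : ℕ} (π : Equiv.Perm (Fin n)) :
    ((Finset.range (n + 1)).filter fun k => IsGrassmannian k π).card =
      if des π ≤ 1 then (n + 1 - des π).choose n else 0 := by
  simp only [isGrassmannian_iff]
  split_ifs with h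
  · rcases Nat.le_one_iff_eq_zero_or_eq_one.1 h with h | h
    · have h' : descentSet π = ∅ := Finset.card_eq_zero.1 h
      simp [h, h', Nat.choose_succ_self_right]
    · obtain ⟨i, hi⟩ := Finset.card_eq_one.1 h
      rw [h, hi]
      have : (Finset.range (n + 1)).filter (fun k => ∀ j ∈ ({i} : Finset (Fin n)),
          (j : ℕ) + 1 = k) = {(i : ℕ) + 1} := by
        ext k
        have := i.2
        simp only [Finset.mem_filter, Finset.mem_range, Finset.mem_singleton, forall_eq]
        omega
      rw [this]
      simp
  · obtain ⟨i, hi, j, hj, hij⟩ := Finset.one_lt_card.1 (not_le.1 h)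
    rw [Finset.card_eq_zero, Finset.filter_eq_empty_iff]
    intro k _ hk
    exact hij (Fin.ext (by have := hk i hi; have := hk j hj; omega))

/-- The values, as natural numbers, of a permutation on the first `k` positions. -/
def headValues {n : ℕ} (k : ℕ) (π : Equiv.Perm (Fin n)) : Finset ℕ :=
  (Finset.univ.filter fun i : Fin n => (i : ℕ) < k).image fun i => (π i : ℕ)

theorem apply_mem_headValues {n k : ℕ} {π : Equiv.Perm (Fin n)} {i : Fin n} :
    (π i : ℕ) ∈ headValues k π ↔ (i : ℕ) < k := by
  simp only [headValues, Finset.mem_image, Finset.mem_filter, Finset.mem_univ, true_and]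
  constructor
  · rintro ⟨j, hj, h⟩
    rwa [← π.injective (Fin.ext h)]
  · exact fun h => ⟨i, h, rfl⟩

theorem headValues_mem {n k : ℕ} (hk : k ≤ n) (π : Equiv.Perm (Fin n)) :
    headValues k π ∈ (Finset.range n).powersetCard k := by
  rw [Finset.mem_powersetCard]
  constructor
  · intro x hx
    obtain ⟨i, -, rfl⟩ := Finset.mem_image.1 hx
    simp
  · have hinj : Function.Injective fun i : Fin n => (π i : ℕ) :=
      Fin.val_injective.comp π.injective
    refine (Finset.card_image_of_injective _ hinj).trans ?_
    rw [Fin.card_filter_val_lt]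
    omega

/-- Both blocks are increasing, so an inversion must straddle the cut; its two values form a pair
counted by the weight. -/
theorem inv_eq_setWeight {n k : ℕ} {π : Equiv.Perm (Fin n)}
    (h : IsGrassmannian k π) : inv π = setWeight (headValues k π) := by
  rw [setWeight, ← Finset.card_sigma, inv]
  have hblock : ∀ i j : Fin n, i < j → π j < π i → (i : ℕ) < k ∧ k ≤ (j : ℕ) := by
    intro i j hij hd
    by_contra hc
    exact absurd (h i j hij (by omega)) hd.not_gt
  refine Finset.card_bij (fun ij _ => ⟨(π ij.1 : ℕ), (π ij.2 : ℕ)⟩) ?_ ?_ ?_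
  · rintro ⟨i, j⟩ hij
    simp only [Finset.mem_filter, Finset.mem_univ, true_and] at hij
    have := hblock i j hij.1 hij.2
    simp only [Finset.mem_sigma, Finset.mem_sdiff, Finset.mem_range, apply_mem_headValues]
    exact ⟨this.1, Fin.lt_def.1 hij.2, by omega⟩
  · rintro ⟨i, j⟩ - ⟨i', j'⟩ - h
    rw [Sigma.mk.injEq] at h
    have h1 := π.injective (Fin.ext h.1)
    have h2 := π.injective (Fin.ext (eq_of_heq h.2))
    exact Prod.ext h1 h2
  · rintro ⟨y, x⟩ hyx
    simp only [Finset.mem_sigma, Finset.mem_sdiff, Finset.mem_range] at hyx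
    obtain ⟨hy, hxy, hx⟩ := hyx
    obtain ⟨i, hi, rfl⟩ : ∃ i ∈ _, (π i : ℕ) = y := Finset.mem_image.1 hy
    simp only [Finset.mem_filter, Finset.mem_univ, true_and] at hi
    obtain ⟨j, hj⟩ := π.surjective ⟨x, lt_trans hxy (π i).isLt⟩
    have hjx : (π j : ℕ) = x := by rw [hj]
    subst hjx
    rw [apply_mem_headValues] at hx
    refine ⟨(i, j), ?_, rfl⟩
    simp only [Finset.mem_filter, Finset.mem_univ, true_and]
    exact ⟨Fin.lt_def.2 (by omega), Fin.lt_def.2 hxy⟩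

/-- The permutation `ρ⁻¹π` preserves the two blocks and is increasing on each, hence it is
increasing and therefore the identity. -/
theorem headValues_injOn {n k : ℕ} {π ρ : Equiv.Perm (Fin n)} (hπ : IsGrassmannian k π)
    (hρ : IsGrassmannian k ρ) (h : headValues k π = headValues k ρ) : π = ρ := by
  have hS : ∀ i : Fin n, (i : ℕ) < k ↔ ((ρ.symm (π i) : Fin n) : ℕ) < k := fun i => by
    rw [← apply_mem_headValues (π := π), h, ← apply_mem_headValues (π := ρ),
      Equiv.apply_symm_apply]
  have hmono : ∀ i j : Fin n, i < j → ρ.symm (π i) < ρ.symm (π j) := by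
    intro i j hij
    by_cases hb : (j : ℕ) < k ∨ k ≤ (i : ℕ)
    · have h1 := hπ i j hij hb
      by_contra hc
      rcases (not_lt.1 hc).eq_or_lt with he | hl
      · rw [ρ.symm.injective he] at h1
        exact lt_irrefl _ h1
      · have := hρ _ _ hl (by have := hS i; have := hS j; omega)
        rw [Equiv.apply_symm_apply, Equiv.apply_symm_apply] at this
        exact absurd h1 this.not_gt
    · have := hS i
      have := hS j
      exact Fin.lt_def.2 (by omega)
  have hid : (fun i => ρ.symm (π i)) = id :=
    (StrictMono.range_inj (fun i j hij => hmono i j hij) strictMono_id).1 (by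
      rw [Set.range_id, Set.range_eq_univ]
      exact ρ.symm.surjective.comp π.surjective)
  ext1 i
  exact ((Equiv.symm_apply_eq ρ).1 (congrFun hid i))

/-- The permutation lists `S` in increasing order and then its complement in increasing order. -/
theorem exists_isGrassmannian {n k : ℕ} {S : Finset ℕ}
    (hS : S ∈ (Finset.range n).powersetCard k) :
    ∃ π : Equiv.Perm (Fin n), IsGrassmannian k π ∧ headValues k π = S := by
  obtain ⟨hSn, hSk⟩ := Finset.mem_powersetCard.1 hS
  have hkn : k ≤ n := by simpa [hSk] using Finset.card_le_card hSn
  obtain ⟨m, rfl⟩ := Nat.exists_eq_add_of_le hkn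
  let T : Finset (Fin (k + m)) := Finset.univ.filter fun i => (i : ℕ) ∈ S
  have hTS : T.image (fun i : Fin (k + m) => (i : ℕ)) = S := by
    ext x
    simp only [T, Finset.mem_image, Finset.mem_filter, Finset.mem_univ, true_and]
    exact ⟨by rintro ⟨i, hi, rfl⟩; exact hi, fun hx => ⟨⟨x, by simpa using hSn hx⟩, hx, rfl⟩⟩
  have hT : T.card = k := by
    have := Finset.card_image_of_injective T Fin.val_injective
    exact this.symm.trans ((congrArg Finset.card hTS).trans hSk)
  have hT' : Tᶜ.card = m := by rw [Finset.card_compl, hT]; simp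
  let π : Equiv.Perm (Fin (k + m)) := finSumFinEquiv.symm.trans (finSumEquivOfFinset hT hT')
  have hl : ∀ i : Fin k, π (Fin.castAdd m i) = T.orderEmbOfFin hT i := fun i => by simp [π]
  have hr : ∀ i : Fin m, π (Fin.natAdd k i) = Tᶜ.orderEmbOfFin hT' i := fun i => by simp [π]
  refine ⟨π, ?_, ?_⟩
  · intro i j hij hb
    induction i using Fin.addCases with
    | left i =>
      induction j using Fin.addCases with
      | left j => rw [hl, hl]; exact (T.orderEmbOfFin hT).strictMono hij
      | right j =>
        have := i.2
        simp at hb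
        omega
    | right i =>
      induction j using Fin.addCases with
      | left j =>
        have := j.2
        rw [Fin.lt_def] at hij
        simp at hij
        omega
      | right j =>
        rw [hr, hr]
        refine (Tᶜ.orderEmbOfFin hT').strictMono ?_
        rw [Fin.lt_def] at hij ⊢
        simpa using hij
  · refine Finset.eq_of_subset_of_card_le ?_ ?_
    · intro x hx
      obtain ⟨i, hi, rfl⟩ := Finset.mem_image.1 hx
      simp only [Finset.mem_filter, Finset.mem_univ, true_and] at hi
      have : i = Fin.castAdd m ⟨i, hi⟩ := rfl
      rw [this, hl]
      have := T.orderEmbOfFin_mem hT ⟨i, hi⟩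
      exact (Finset.mem_filter.1 this).2
    · rw [hSk, (Finset.mem_powersetCard.1 (headValues_mem hkn π)).2]

/-- The number of all codes of length `n`, as a sum over permutations with at most one
descent. -/
theorem sum_des_le_one (F : Type*) [Field F] [Finite F] (n : ℕ) :
    ∑ π : Equiv.Perm (Fin n) with des π ≤ 1,
      (n + 1 - des π).choose n * Nat.card F ^ inv π = Nat.card (LinCode F n) := by
  classical
  rw [card_linCode_eq_sum, Finset.sum_filter]
  have h1 : ∀ π : Equiv.Perm (Fin n),
      (if des π ≤ 1 then (n + 1 - des π).choose n * Nat.card F ^ inv π else 0) =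
      ∑ k ∈ Finset.range (n + 1), if IsGrassmannian k π then Nat.card F ^ inv π else 0 := by
    intro π
    rw [← Finset.sum_filter, Finset.sum_const, card_isGrassmannian, smul_eq_mul, ite_mul,
      zero_mul]
  rw [Finset.sum_congr rfl fun π _ => h1 π, Finset.sum_comm]
  refine Finset.sum_congr rfl fun k hk => ?_
  have hk : k ≤ n := by simp at hk; omega
  rw [← Finset.sum_filter, ← sum_pow_setWeight]
  refine Finset.sum_bij (fun π _ => headValues k π) ?_ ?_ ?_ ?_
  · exact fun π _ => headValues_mem hk π
  · exact fun π hπ ρ hρ h =>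
      headValues_injOn (Finset.mem_filter.1 hπ).2 (Finset.mem_filter.1 hρ).2 h
  · intro S hS
    obtain ⟨π, h1, h2⟩ := exists_isGrassmannian hS
    exact ⟨π, Finset.mem_filter.2 ⟨Finset.mem_univ _, h1⟩, h2⟩
  · intro π hπ
    rw [inv_eq_setWeight (Finset.mem_filter.1 hπ).2]
-- Upper bounds for the number of invariant subspaces.
section InvariantSubspaces

open Module

theorem card_linCode_mono (F : Type*) [Field F] [Finite F] {m n : ℕ} (h : m ≤ n) :
    Nat.card (LinCode F m) ≤ Nat.card (LinCode F n) := by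
  refine monotone_nat_of_le_succ (f := fun n => Nat.card (LinCode F n)) (fun n => ?_) h
  simp only [card_linCode_eq_sum]
  rw [Finset.sum_range_succ _ (n + 1)]
  refine le_add_right (Finset.sum_le_sum fun k hk => ?_)
  cases k with
  | zero => simp [numSubspaces_zero_right]
  | succ k =>
    rw [numSubspaces_succ_succ (by simp at hk; omega)]
    exact Nat.le_add_right _ _

variable {F : Type*} [Field F] {V : Type*} [AddCommGroup V] [Module F V]

/-- The subspaces mapped into themselves by `T`. -/
def IsStableUnder (T : V → V) (W : Submodule F V) : Prop := ∀ w ∈ W, T w ∈ W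

/-- The least `T`-invariant subspace which contains `M` and `v`. -/
def adjoinInvariant (T : V → V) (M : Submodule F V) (v : V) : Submodule F V :=
  sInf {N | IsStableUnder T N ∧ M ≤ N ∧ v ∈ N}

theorem isStableUnder_adjoin (T : V → V) (M : Submodule F V) (v : V) :
    IsStableUnder T (adjoinInvariant T M v) := by
  intro w hw
  rw [adjoinInvariant, Submodule.mem_sInf] at *
  exact fun N hN => hN.1 w (hw N hN)

theorem le_adjoinInvariant (T : V → V) (M : Submodule F V) (v : V) :
    M ≤ adjoinInvariant T M v :=
  le_sInf fun _ hN => hN.2.1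

theorem mem_adjoinInvariant (T : V → V) (M : Submodule F V) (v : V) :
    v ∈ adjoinInvariant T M v :=
  Submodule.mem_sInf.2 fun _ hN => hN.2.2

theorem adjoinInvariant_le {T : V → V} {M W : Submodule F V} {v : V} (hW : IsStableUnder T W)
    (hM : M ≤ W) (hv : v ∈ W) : adjoinInvariant T M v ≤ W :=
  sInf_le ⟨hW, hM, hv⟩

/-- The invariant subspace generated by `M` and a tuple of vectors. -/
def adjoinTuple (T : V → V) : (g : ℕ) → Submodule F V → (Fin g → V) → Submodule F V
  | 0, M, _ => M
  | g + 1, M, w => adjoinTuple T g (adjoinInvariant T M (w 0)) (Fin.tail w)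

theorem card_adjoinTuple_succ [Fintype V] (T : V → V) (g : ℕ) (M W : Submodule F V) :
    Nat.card {w : Fin (g + 1) → V // adjoinTuple T (g + 1) M w = W} =
      ∑ v : V, Nat.card {w : Fin g → V // adjoinTuple T g (adjoinInvariant T M v) w = W} := by
  rw [← Nat.card_sigma]
  refine Nat.card_congr
    { toFun := fun w => ⟨w.1 0, Fin.tail w.1, w.2⟩
      invFun := fun w => ⟨Fin.cons w.1 w.2.1, by simpa [adjoinTuple] using w.2.2⟩
      left_inv := fun w => Subtype.ext (by simp)
      right_inv := fun w => Sigma.subtype_ext (by simp) (by simp) }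

variable [FiniteDimensional F V]

theorem finrank_comap_le (S : V →ₗ[F] V) (A : Submodule F V) :
    finrank F (A.comap S) ≤ finrank F (LinearMap.ker S) + finrank F A := by
  have h := (S.domRestrict (A.comap S)).finrank_range_add_finrank_ker
  have h1 : finrank F (LinearMap.range (S.domRestrict (A.comap S))) ≤ finrank F A := by
    refine Submodule.finrank_mono ?_
    rintro _ ⟨⟨x, hx⟩, rfl⟩
    exact hx
  have h2 : finrank F (LinearMap.ker (S.domRestrict (A.comap S))) ≤
      finrank F (LinearMap.ker S) := by
    rw [(Submodule.equivMapOfInjective _ (A.comap S).subtype_injective _).finrank_eq]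
    refine Submodule.finrank_mono ?_
    rintro _ ⟨⟨x, hx⟩, hx', rfl⟩
    exact hx'
  omega

theorem card_submodule_le_eq (H : Submodule F V) :
    Nat.card {W : Submodule F V // W ≤ H} = Nat.card (LinCode F (finrank F H)) := by
  rw [← card_submodule_eq (V := H)]
  exact (Nat.card_congr (Submodule.mapIic H).toEquiv).symm

/-- A subspace between `A` and `B` is recovered from its image in the quotient by `A`. -/
theorem card_submodule_interval_le [Finite F] (A B : Submodule F V) :
    Nat.card {W : Submodule F V // A ≤ W ∧ W ≤ B} ≤
      Nat.card (LinCode F (finrank F (B.map A.mkQ))) := by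
  have : Finite V := Module.finite_of_finite F
  have : Finite (V ⧸ A) := Module.finite_of_finite F
  rw [← card_submodule_le_eq]
  refine Nat.card_le_card_of_injective (fun W => ⟨W.1.map A.mkQ, Submodule.map_mono W.2.2⟩) ?_
  intro W W' h
  have h := congrArg (Submodule.comap A.mkQ) (Subtype.mk.inj h)
  rw [Submodule.comap_map_mkQ, Submodule.comap_map_mkQ, sup_eq_right.2 W.2.1,
    sup_eq_right.2 W'.2.1] at h
  exact Subtype.ext h

theorem finrank_map_mkQ_comap_le (S : V →ₗ[F] V) (A : Submodule F V) (hA : A ≤ A.comap S) :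
    finrank F ((A.comap S).map A.mkQ) ≤ finrank F (LinearMap.ker S) := by
  have h := (A.mkQ.domRestrict (A.comap S)).finrank_range_add_finrank_ker
  rw [LinearMap.range_domRestrict] at h
  have h1 : finrank F A ≤ finrank F (LinearMap.ker (A.mkQ.domRestrict (A.comap S))) := by
    rw [(Submodule.equivMapOfInjective _ (A.comap S).subtype_injective _).finrank_eq]
    refine Submodule.finrank_mono fun x hx => ⟨⟨x, hA hx⟩, ?_, rfl⟩
    simpa using hx
  have := finrank_comap_le S A
  omega

/-- An endomorphism with image of dimension `r` and kernel of dimension `e` has at most as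
many invariant subspaces as there are pairs of subspaces of spaces of dimensions `r` and
`e`. -/
theorem card_invariant_le_mul [Finite F] (S : V →ₗ[F] V) :
    Nat.card {W : Submodule F V // W.map S ≤ W} ≤
      Nat.card (LinCode F (finrank F (LinearMap.range S))) *
        Nat.card (LinCode F (finrank F (LinearMap.ker S))) := by
  have : Finite V := Module.finite_of_finite F
  have : Fintype {A : Submodule F V // A ≤ LinearMap.range S} := Fintype.ofFinite _
  -- With `A = S(W)`, invariance means `A ≤ W ≤ S⁻¹(A)`. So `W` is given by a subspace `A` of the
  -- image and a subspace of `S⁻¹(A)/A`, whose dimension is at most that of the kernel. The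
  -- condition that `A` is invariant is put in the fibre, which is then empty for the other `A`.
  let g : {W : Submodule F V // W.map S ≤ W} → Σ A : {A : Submodule F V // A ≤ LinearMap.range S},
      {W : Submodule F V // A.1 ≤ A.1.comap S ∧ A.1 ≤ W ∧ W ≤ A.1.comap S} := fun W =>
    ⟨⟨W.1.map S, LinearMap.map_le_range⟩, W.1, (Submodule.map_le_iff_le_comap.1
      (Submodule.map_mono W.2)), W.2, Submodule.le_comap_map S W.1⟩
  have hg : Function.Injective g := by
    intro W W' h
    have : (g W).2.1 = (g W').2.1 := by rw [h]
    exact Subtype.ext this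
  refine (Nat.card_le_card_of_injective g hg).trans ?_
  rw [Nat.card_sigma, ← card_submodule_le_eq (LinearMap.range S)]
  refine (Finset.sum_le_card_nsmul _ _ (Nat.card (LinCode F (finrank F (LinearMap.ker S))))
    fun A _ => ?_).trans_eq (by rw [Finset.card_univ, ← Nat.card_eq_fintype_card, smul_eq_mul])
  by_cases hA : A.1 ≤ A.1.comap S
  · refine le_trans (le_of_eq (Nat.card_congr (Equiv.subtypeEquivRight fun W => ?_)))
      ((card_submodule_interval_le A.1 (A.1.comap S)).trans
        (card_linCode_mono F (finrank_map_mkQ_comap_le S A.1 hA)))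
    simp [hA]
  · have : IsEmpty {W : Submodule F V // A.1 ≤ A.1.comap S ∧ A.1 ≤ W ∧ W ≤ A.1.comap S} :=
      ⟨fun W => hA W.2.1⟩
    rw [Nat.card_of_isEmpty]
    exact Nat.zero_le _

theorem finrank_add_one_le_adjoin {T : V → V} {M : Submodule F V} {v : V} (hv : v ∉ M) :
    finrank F M + 1 ≤ finrank F (adjoinInvariant T M v) := by
  refine Submodule.finrank_lt_finrank_of_lt (lt_of_le_of_ne (le_adjoinInvariant T M v) ?_)
  intro h
  exact hv (h ▸ mem_adjoinInvariant T M v)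

theorem finrank_add_two_le_adjoin {T : V → V} {M : Submodule F V} {v : V}
    (hM : IsStableUnder T M) (hv : T v ∉ M ⊔ Submodule.span F {v}) :
    finrank F M + 2 ≤ finrank F (adjoinInvariant T M v) := by
  have hvM : v ∉ M := fun h => hv (Submodule.mem_sup_left (hM v h))
  have h1 : M < M ⊔ Submodule.span F {v} := by
    refine lt_of_le_of_ne le_sup_left fun h => hvM ?_
    rw [h]
    exact Submodule.mem_sup_right (Submodule.mem_span_singleton_self v)
  have h2 : M ⊔ Submodule.span F {v} < adjoinInvariant T M v := by
    refine lt_of_le_of_ne (sup_le (le_adjoinInvariant T M v) ?_) fun h => hv ?_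
    · simpa using mem_adjoinInvariant T M v
    · rw [h]
      exact isStableUnder_adjoin T M v v (mem_adjoinInvariant T M v)
  have := Submodule.finrank_lt_finrank_of_lt h1
  have := Submodule.finrank_lt_finrank_of_lt h2
  omega

/-- A large part of the `g`-tuples of vectors of `W` generates `W` over `M`, if `g` is big
enough and most of the vectors raise the dimension by at least two. -/
theorem pow_le_card_adjoinTuple [Finite F] {T : V → V} {s : ℕ}
    (hs : ∀ M W : Submodule F V, IsStableUnder T M → IsStableUnder T W → M ≤ W →
      finrank F M + s ≤ finrank F W →
      2 * {w | w ∈ W ∧ T w ∈ M ⊔ Submodule.span F {w}}.ncard ≤ Nat.card F ^ finrank F W)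
    (g : ℕ) (M W : Submodule F V) (hM : IsStableUnder T M) (hW : IsStableUnder T W) (hMW : M ≤ W)
    (d : ℕ) (hd : finrank F W = finrank F M + d) (hg : d + min d s ≤ 2 * g) :
    Nat.card F ^ (finrank F W * g) ≤
      2 ^ g * Nat.card {w : Fin g → V // adjoinTuple T g M w = W} := by
  classical
  have : Finite V := Module.finite_of_finite F
  have : Fintype V := Fintype.ofFinite V
  have hcard : ∀ U : Submodule F V, (U : Set V).ncard = Nat.card F ^ finrank F U := fun U => by
    rw [← natCard_eq_pow_finrank (K := F) (V := U)]
    rfl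
  induction g generalizing M d with
  | zero =>
    obtain rfl : d = 0 := by omega
    have h : M = W := Submodule.eq_of_le_of_finrank_eq hMW hd.symm
    have : Nonempty {w : Fin 0 → V // adjoinTuple T 0 M w = W} := ⟨⟨Fin.elim0, h⟩⟩
    rw [mul_zero, pow_zero, pow_zero, one_mul]
    exact Nat.card_pos
  | succ g ih =>
    -- At least half of the vectors of `W` lower the potential `d + min d s` by two, or keep it at
    -- zero. For `0 < d < s` any vector outside `M` lowers both summands by one; for `s ≤ d` the
    -- hypothesis `hs` supplies vectors that lower `d` itself by two.
    obtain ⟨A, hA, hAW, hAd⟩ : ∃ A : Set V, Nat.card F ^ finrank F W ≤ 2 * A.ncard ∧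
        A ⊆ W ∧ ∀ v ∈ A, ∀ d', finrank F W = finrank F (adjoinInvariant T M v) + d' →
          d' + min d' s ≤ 2 * g := by
      have hle : ∀ v, finrank F M ≤ finrank F (adjoinInvariant T M v) := fun v =>
        Submodule.finrank_mono (le_adjoinInvariant T M v)
      rcases Nat.eq_zero_or_pos d with rfl | hd0
      · refine ⟨W, ?_, le_rfl, fun v hv d' hd' => ?_⟩
        · rw [hcard]; omega
        · have := hle v
          omega
      rcases Nat.lt_or_ge d s with hds | hds
      · refine ⟨W \ M, ?_, Set.sdiff_subset, fun v hv d' hd' => ?_⟩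
        · have h1 := Set.ncard_sdiff_add_ncard_of_subset (show (M : Set V) ⊆ W from hMW)
          rw [hcard, hcard] at h1
          have h2 : 2 * Nat.card F ^ finrank F M ≤ Nat.card F ^ finrank F W := by
            have hq : 2 ≤ Nat.card F := Finite.one_lt_card
            calc 2 * Nat.card F ^ finrank F M ≤ Nat.card F * Nat.card F ^ finrank F M :=
                  Nat.mul_le_mul_right _ hq
              _ = Nat.card F ^ (finrank F M + 1) := by rw [pow_succ, mul_comm]
              _ ≤ _ := Nat.pow_le_pow_right Nat.card_pos (by omega)
          omega
        · have := finrank_add_one_le_adjoin (T := T) hv.2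
          omega
      · refine ⟨W \ {w | w ∈ W ∧ T w ∈ M ⊔ Submodule.span F {w}}, ?_, Set.sdiff_subset,
          fun v hv d' hd' => ?_⟩
        · have h1 := Set.ncard_sdiff_add_ncard_of_subset
            (show {w | w ∈ W ∧ T w ∈ M ⊔ Submodule.span F {w}} ⊆ (W : Set V) from
              fun w hw => hw.1)
          rw [hcard] at h1
          have h2 := hs M W hM hW hMW (by omega)
          omega
        · have := finrank_add_two_le_adjoin (T := T) (v := v) hM fun h => hv.2 ⟨hv.1, h⟩
          omega
    rw [card_adjoinTuple_succ]
    have hstep : ∀ v ∈ A, Nat.card F ^ (finrank F W * g) ≤ 2 ^ g *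
        Nat.card {w : Fin g → V // adjoinTuple T g (adjoinInvariant T M v) w = W} := by
      intro v hv
      have hle := adjoinInvariant_le hW hMW (hAW hv)
      obtain ⟨d', hd'⟩ := Nat.exists_eq_add_of_le (Submodule.finrank_mono hle)
      exact ih _ (isStableUnder_adjoin T M v) hle d' hd' (hAd v hv d' hd')
    rw [Set.ncard_eq_toFinset_card'] at hA
    calc Nat.card F ^ (finrank F W * (g + 1))
        = Nat.card F ^ finrank F W * Nat.card F ^ (finrank F W * g) := by
          rw [← pow_add]; congr 1; ring
      _ ≤ 2 * A.toFinset.card * Nat.card F ^ (finrank F W * g) := Nat.mul_le_mul_right _ hA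
      _ = 2 * ∑ v ∈ A.toFinset, Nat.card F ^ (finrank F W * g) := by
          rw [Finset.sum_const, smul_eq_mul, mul_assoc]
      _ ≤ 2 * ∑ v ∈ A.toFinset, 2 ^ g *
            Nat.card {w : Fin g → V // adjoinTuple T g (adjoinInvariant T M v) w = W} :=
          Nat.mul_le_mul_left _ (Finset.sum_le_sum fun v hv => hstep v (by simpa using hv))
      _ ≤ 2 * ∑ v : V, 2 ^ g *
            Nat.card {w : Fin g → V // adjoinTuple T g (adjoinInvariant T M v) w = W} :=
          Nat.mul_le_mul_left _ (Finset.sum_le_sum_of_subset (Finset.subset_univ _))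
      _ = _ := by rw [← Finset.mul_sum, ← mul_assoc, pow_succ']

/-- A tuple determines the invariant subspace that it generates, so the sets of generating
`g`-tuples of different `W` are disjoint in `V^g`; each has at least `q^(kg)/2^g` elements. -/
theorem card_invariant_finrank_mul_le [Finite F] {T : V → V} (hT : T 0 = 0) {s : ℕ}
    (hs : ∀ M W : Submodule F V, IsStableUnder T M → IsStableUnder T W → M ≤ W →
      finrank F M + s ≤ finrank F W →
      2 * {w | w ∈ W ∧ T w ∈ M ⊔ Submodule.span F {w}}.ncard ≤ Nat.card F ^ finrank F W)
    {g k : ℕ} (hg : k + s ≤ 2 * g) :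
    Nat.card {W : Submodule F V // IsStableUnder T W ∧ finrank F W = k} * Nat.card F ^ (k * g) ≤
      2 ^ g * Nat.card F ^ (finrank F V * g) := by
  have : Finite V := Module.finite_of_finite F
  have : Fintype {W : Submodule F V // IsStableUnder T W ∧ finrank F W = k} := Fintype.ofFinite _
  let e : (Σ W : {W : Submodule F V // IsStableUnder T W ∧ finrank F W = k},
      {w : Fin g → V // adjoinTuple T g ⊥ w = W.1}) → (Fin g → V) := fun x => x.2.1
  have he : Function.Injective e := by
    rintro ⟨W, w, hw⟩ ⟨W', w', hw'⟩ h
    have h : w = w' := h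
    subst h
    exact Sigma.subtype_ext (Subtype.ext (hw.symm.trans hw')) rfl
  have h1 := Nat.card_le_card_of_injective e he
  rw [Nat.card_sigma, Nat.card_fun, natCard_eq_pow_finrank (K := F) (V := V),
    Nat.card_fin, ← pow_mul] at h1
  refine le_trans ?_ (Nat.mul_le_mul_left _ h1)
  rw [Finset.mul_sum, Nat.card_eq_fintype_card, ← smul_eq_mul, ← Finset.card_univ]
  refine Finset.card_nsmul_le_sum _ _ _ fun W _ => ?_
  have := pow_le_card_adjoinTuple hs g ⊥ W.1 (fun w hw => by
    rw [Submodule.mem_bot] at hw ⊢; rw [hw, hT]) W.2.1 bot_le k (by simp [W.2.2]) (by omega)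
  rwa [W.2.2] at this

/-- With `g` about `(k + s)/2` generators and `2^g ≤ q^g`, dimension `k` contributes at most
`q^(g(n-k+1))`. By the inequality of arithmetic and geometric means `(k + s + 1)(n - k + 1)/2` is at
most `(n + s + 2)²/8`. The leading term `n²/8`, half of `n²/4`, is the gain. -/
theorem card_invariant_le_pow [Finite F] {T : V → V} (hT : T 0 = 0) {s : ℕ}
    (hs : ∀ M W : Submodule F V, IsStableUnder T M → IsStableUnder T W → M ≤ W →
      finrank F M + s ≤ finrank F W →
      2 * {w | w ∈ W ∧ T w ∈ M ⊔ Submodule.span F {w}}.ncard ≤ Nat.card F ^ finrank F W) :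
    Nat.card {W : Submodule F V // IsStableUnder T W} ≤
      (finrank F V + 1) * Nat.card F ^ ((finrank F V + s + 2) ^ 2 / 8) := by
  classical
  have : Finite V := Module.finite_of_finite F
  have : Fintype (Submodule F V) := Fintype.ofFinite _
  set n := finrank F V
  rw [Nat.card_eq_fintype_card, Fintype.card_subtype,
    Finset.card_eq_sum_card_fiberwise (f := fun W : Submodule F V => finrank F W)
      (t := Finset.range (n + 1)) fun W _ => by
        have := Submodule.finrank_le W
        simp; omega]
  refine (Finset.sum_le_card_nsmul _ _ (Nat.card F ^ ((n + s + 2) ^ 2 / 8))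
    fun k hk => ?_).trans_eq (by simp)
  have hk : k ≤ n := by simp at hk; omega
  rw [Finset.filter_filter, ← Fintype.card_subtype, ← Nat.card_eq_fintype_card]
  obtain ⟨g, hg1, hg2⟩ : ∃ g, k + s ≤ 2 * g ∧ 2 * g ≤ k + s + 1 :=
    ⟨(k + s + 1) / 2, by omega, by omega⟩
  have h := card_invariant_finrank_mul_le hT hs hg1
  have hq : 2 ≤ Nat.card F := Finite.one_lt_card
  have h2 : Nat.card {W : Submodule F V // IsStableUnder T W ∧ finrank F W = k} *
      Nat.card F ^ (k * g) ≤ Nat.card F ^ (g * (n - k + 1)) * Nat.card F ^ (k * g) := by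
    refine h.trans ((Nat.mul_le_mul_right _ (Nat.pow_le_pow_left hq g)).trans_eq ?_)
    rw [← pow_add, ← pow_add]
    obtain ⟨m, hm⟩ := Nat.exists_eq_add_of_le hk
    congr 1
    change g + n * g = _
    rw [hm, Nat.add_sub_cancel_left]
    ring
  refine (Nat.le_of_mul_le_mul_right h2 (pow_pos Nat.card_pos _)).trans
    (Nat.pow_le_pow_right Nat.card_pos ?_)
  rw [Nat.le_div_iff_mul_le (by norm_num)]
  obtain ⟨m, hm⟩ := Nat.exists_eq_add_of_le hk
  rw [hm, Nat.add_sub_cancel_left]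
  zify at hg2 ⊢
  nlinarith [sq_nonneg ((m : ℤ) - (k + s)), mul_le_mul_of_nonneg_right hg2
    (show (0 : ℤ) ≤ m + 1 by positivity)]

end InvariantSubspaces
-- Few vectors are eigenvectors modulo an invariant subspace.
section Eigenvectors

open Module

variable {F : Type*} [Field F] {V : Type*} [AddCommGroup V] [Module F V]
  [FiniteDimensional F V]

theorem ncard_submodule (U : Submodule F V) :
    (U : Set V).ncard = Nat.card F ^ finrank F U := by
  rw [← natCard_eq_pow_finrank (K := F) (V := U)]
  rfl

variable [Finite F]

theorem ncard_eigenvectors_mod_le (T : V → V) (M W : Submodule F V) (b : ℕ)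
    (hb : ∀ c : F, {w | w ∈ W ∧ T w - c • w ∈ M}.ncard ≤ b) :
    {w | w ∈ W ∧ T w ∈ M ⊔ Submodule.span F {w}}.ncard ≤ Nat.card F * b := by
  classical
  have : Finite V := Module.finite_of_finite F
  have : Fintype F := Fintype.ofFinite F
  have hsub : {w | w ∈ W ∧ T w ∈ M ⊔ Submodule.span F {w}} ⊆
      ⋃ c ∈ (Finset.univ : Finset F), {w | w ∈ W ∧ T w - c • w ∈ M} := by
    rintro w ⟨hw, h⟩
    obtain ⟨m, hm, z, hz, h⟩ := Submodule.mem_sup.1 h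
    obtain ⟨c, rfl⟩ := Submodule.mem_span_singleton.1 hz
    simp only [Set.mem_iUnion, Finset.mem_univ, exists_prop, true_and]
    exact ⟨c, hw, by rwa [← h, add_sub_cancel_right]⟩
  refine (Set.ncard_le_ncard hsub (Set.toFinite _)).trans ?_
  refine (Finset.set_ncard_biUnion_le _ _).trans ?_
  refine (Finset.sum_le_card_nsmul _ _ b fun c _ => hb c).trans_eq ?_
  rw [Finset.card_univ, smul_eq_mul, Nat.card_eq_fintype_card]

/-- For each of the `q` values of `c`, the eigenvectors modulo `M` form a space of dimension at most
`e + dim M`. The sum over `c` and the factor `2 ≤ q` cost two more powers of `q`, whence `s = e +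
2`. -/
theorem card_invariant_le_of_eigenspaces (T : V →ₗ[F] V) {e : ℕ}
    (he : ∀ c : F, finrank F (LinearMap.ker (T - c • LinearMap.id)) ≤ e) :
    Nat.card {W : Submodule F V // IsStableUnder T W} ≤
      (finrank F V + 1) * Nat.card F ^ ((finrank F V + (e + 2) + 2) ^ 2 / 8) := by
  have : Finite V := Module.finite_of_finite F
  refine card_invariant_le_pow (map_zero T) fun M W _ _ _ hd => ?_
  have hb := ncard_eigenvectors_mod_le T M W (Nat.card F ^ (e + finrank F M)) fun c => by
    have h1 : {w | w ∈ W ∧ T w - c • w ∈ M} ⊆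
        (M.comap (T - c • LinearMap.id) : Submodule F V) := fun w hw => by
      simpa using hw.2
    refine (Set.ncard_le_ncard h1 (Set.toFinite _)).trans ?_
    rw [ncard_submodule]
    exact Nat.pow_le_pow_right Nat.card_pos
      ((finrank_comap_le _ _).trans (Nat.add_le_add_right (he c) _))
  have hq : 2 ≤ Nat.card F := Finite.one_lt_card
  calc _ ≤ Nat.card F * (Nat.card F * Nat.card F ^ (e + finrank F M)) :=
        Nat.mul_le_mul hq hb
    _ = Nat.card F ^ (finrank F M + (e + 2)) := by ring
    _ ≤ _ := Nat.pow_le_pow_right Nat.card_pos hd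

/-- Let `E` be the set on the left. The map `(x, y) ↦ x + a y` from `E × E` to `W` has fibres of
size at most `|M|`. Indeed, if `u = -a u'` with `u`, `u'` both eigenvectors modulo `M` for `c`, then
comparing `T u ≡ c u` with `T u = -τ(a) T u'` gives `(a - τ a) c u' ∈ M`. -/
theorem ncard_semilinear_eigenvectors_sq_le {τ : F →+* F} {a : F} (ha : τ a ≠ a)
    {T : V →ₛₗ[τ] V} (hT : Function.Injective T) {M W : Submodule F V}
    (hM : IsStableUnder T M) (c : F) :
    {w | w ∈ W ∧ T w - c • w ∈ M}.ncard ^ 2 ≤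
      Nat.card F ^ (finrank F W + finrank F M) := by
  classical
  have : Finite V := Module.finite_of_finite F
  have : Fintype V := Fintype.ofFinite V
  -- `T` maps the finite set `M` injectively into itself, hence onto itself. This settles the case
  -- `c = 0`.
  have hmem : ∀ u, T u ∈ M → u ∈ M := by
    intro u hu
    have hinj : Function.Injective fun m : M => (⟨T m, hM m m.2⟩ : M) := fun x y h =>
      Subtype.ext (hT (Subtype.mk.inj h))
    obtain ⟨m, hm⟩ := (Finite.injective_iff_surjective.1 hinj) ⟨T u, hu⟩
    have := hT (Subtype.mk.inj hm)
    exact this ▸ m.2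
  have key : ∀ u u' : V, T u - c • u ∈ M → T u' - c • u' ∈ M → u + a • u' = 0 → u' ∈ M := by
    intro u u' hu hu' h
    by_cases hc : c = 0
    · exact hmem u' (by simpa [hc] using hu')
    have h1 : T u + τ a • T u' = 0 := by
      rw [← map_smulₛₗ, ← map_add, h, map_zero]
    have h2 : ((a - τ a) * c) • u' ∈ M := by
      have : ((a - τ a) * c) • u' = (T u - c • u) + τ a • (T u' - c • u') := by
        have hu0 : u = -(a • u') := eq_neg_of_add_eq_zero_left h
        have hT0 : T u = -(τ a • T u') := eq_neg_of_add_eq_zero_left h1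
        rw [hT0, hu0]
        module
      rw [this]
      exact M.add_mem hu (M.smul_mem _ hu')
    exact (M.smul_mem_iff (mul_ne_zero (sub_ne_zero.2 ha.symm) hc)).1 h2
  set E := {w | w ∈ W ∧ T w - c • w ∈ M} with hE
  have hsub : ∀ x ∈ E, ∀ y ∈ E, T (x - y) - c • (x - y) ∈ M := by
    intro x hx y hy
    have : T (x - y) - c • (x - y) = (T x - c • x) - (T y - c • y) := by
      rw [map_sub, smul_sub]; abel
    rw [this]
    exact M.sub_mem hx.2 hy.2
  let f : V × V → V := fun x => x.1 + a • x.2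
  have hfib := Finset.card_le_mul_card_image (f := f) (E.toFinset ×ˢ E.toFinset)
    (Nat.card F ^ finrank F M) (by
      intro y hy
      obtain ⟨x0, hx0, rfl⟩ := Finset.mem_image.1 hy
      rw [← ncard_submodule M, Set.ncard_eq_toFinset_card']
      refine Finset.card_le_card_of_injOn (fun x => x.2 - x0.2) ?_ ?_
      · intro x hx
        simp only [Finset.coe_filter, Finset.mem_product, Set.mem_toFinset,
          Set.mem_ofPred_eq] at hx
        simp only [Finset.mem_product, Set.mem_toFinset] at hx0
        simp only [Set.coe_toFinset, SetLike.mem_coe]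
        refine key (x.1 - x0.1) _ (hsub _ hx.1.1 _ hx0.1) (hsub _ hx.1.2 _ hx0.2) ?_
        have h : x.1 + a • x.2 = x0.1 + a • x0.2 := hx.2
        have : x.1 - x0.1 + a • (x.2 - x0.2) = (x.1 + a • x.2) - (x0.1 + a • x0.2) := by
          rw [smul_sub]; abel
        rw [this, h, sub_self]
      · intro x hx y hy h
        simp only [Finset.coe_filter, Set.mem_ofPred_eq] at hx hy
        have h2 : x.2 = y.2 := sub_left_injective h
        have h1 : x.1 + a • x.2 = y.1 + a • y.2 := hx.2.trans hy.2.symm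
        rw [h2] at h1
        exact Prod.ext (add_right_cancel h1) h2)
  have himg : ((E.toFinset ×ˢ E.toFinset).image f).card ≤ Nat.card F ^ finrank F W := by
    rw [← ncard_submodule W, Set.ncard_eq_toFinset_card']
    refine Finset.card_le_card fun y hy => ?_
    obtain ⟨x, hx, rfl⟩ := Finset.mem_image.1 hy
    simp only [Finset.mem_product, Set.mem_toFinset] at hx
    simp only [Set.mem_toFinset, SetLike.mem_coe]
    exact W.add_mem hx.1.1 (W.smul_mem _ hx.2.1)
  rw [Set.ncard_eq_toFinset_card', sq, ← Finset.card_product, add_comm, pow_add]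
  exact hfib.trans (Nat.mul_le_mul_left _ himg)

/-- Here `s = 4`: the square of `2q|E|` is at most `q^4 |W| |M|`, which is at most `|W|²` once `dim
W ≥ dim M + 4`. -/
theorem card_invariant_le_of_semilinear {τ : F →+* F} {a : F} (ha : τ a ≠ a)
    {T : V →ₛₗ[τ] V} (hT : Function.Injective T) :
    Nat.card {W : Submodule F V // IsStableUnder T W} ≤
      (finrank F V + 1) * Nat.card F ^ ((finrank F V + 4 + 2) ^ 2 / 8) := by
  refine card_invariant_le_pow (map_zero T) fun M W hM _ _ hd => ?_
  obtain ⟨c, hc⟩ := Finite.exists_max fun c : F => {w | w ∈ W ∧ T w - c • w ∈ M}.ncard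
  have hb := ncard_eigenvectors_mod_le T M W _ hc
  have hsq := ncard_semilinear_eigenvectors_sq_le ha hT (W := W) hM c
  have hq : 2 ≤ Nat.card F := Finite.one_lt_card
  refine (Nat.pow_le_pow_iff_left two_ne_zero).1 ?_
  refine (Nat.pow_le_pow_left (Nat.mul_le_mul hq hb) 2).trans ?_
  calc (Nat.card F * (Nat.card F * {w | w ∈ W ∧ T w - c • w ∈ M}.ncard)) ^ 2
      = Nat.card F ^ 4 * {w | w ∈ W ∧ T w - c • w ∈ M}.ncard ^ 2 := by ring
    _ ≤ Nat.card F ^ 4 * Nat.card F ^ (finrank F W + finrank F M) := Nat.mul_le_mul_left _ hsq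
    _ = Nat.card F ^ (4 + (finrank F W + finrank F M)) := (pow_add _ _ _).symm
    _ ≤ Nat.card F ^ (finrank F W * 2) := Nat.pow_le_pow_right Nat.card_pos (by omega)
    _ = _ := by rw [pow_mul]

end Eigenvectors
-- The group of semilinear monomial maps, its subgroups and Burnside's lemma.
/-- The semilinear monomial map `x ↦ (dᵢ τ(x_{σ i}))ᵢ`, by its data `σ`, `d`, `τ`. -/
@[ext]
structure SemilinMonomial (F : Type*) [Field F] (n : ℕ) where
  perm : Equiv.Perm (Fin n)
  diag : Fin n → Fˣ
  aut : F ≃+* F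

namespace SemilinMonomial

variable {F : Type*} [Field F] {n : ℕ}

/-- The components of a semilinear monomial map. -/
def equivProd (F : Type*) [Field F] (n : ℕ) :
    SemilinMonomial F n ≃ Equiv.Perm (Fin n) × (Fin n → Fˣ) × (F ≃+* F) where
  toFun p := (p.perm, p.diag, p.aut)
  invFun x := ⟨x.1, x.2.1, x.2.2⟩
  left_inv _ := rfl
  right_inv _ := rfl

instance : One (SemilinMonomial F n) := ⟨⟨1, 1, 1⟩⟩

/-- The product is composition of maps; the permutations multiply in reverse order because they act
on the indices. -/
instance : Mul (SemilinMonomial F n) :=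
  ⟨fun p r => ⟨r.perm * p.perm, fun i => p.diag i * Units.map (p.aut : F →* F) (r.diag (p.perm i)),
    p.aut * r.aut⟩⟩

instance : Inv (SemilinMonomial F n) :=
  ⟨fun p => ⟨p.perm⁻¹, fun i => Units.map (p.aut⁻¹ : F ≃+* F) (p.diag (p.perm⁻¹ i))⁻¹, p.aut⁻¹⟩⟩

@[simp] theorem one_perm : (1 : SemilinMonomial F n).perm = 1 := rfl
@[simp] theorem one_diag : (1 : SemilinMonomial F n).diag = 1 := rfl
@[simp] theorem one_aut : (1 : SemilinMonomial F n).aut = 1 := rfl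
@[simp] theorem mul_perm (p r : SemilinMonomial F n) : (p * r).perm = r.perm * p.perm := rfl
@[simp] theorem mul_diag (p r : SemilinMonomial F n) (i : Fin n) :
    (p * r).diag i = p.diag i * Units.map (p.aut : F →* F) (r.diag (p.perm i)) := rfl
@[simp] theorem mul_aut (p r : SemilinMonomial F n) : (p * r).aut = p.aut * r.aut := rfl
@[simp] theorem inv_perm (p : SemilinMonomial F n) : p⁻¹.perm = p.perm⁻¹ := rfl
@[simp] theorem inv_diag (p : SemilinMonomial F n) (i : Fin n) :
    p⁻¹.diag i = Units.map (p.aut⁻¹ : F ≃+* F) (p.diag (p.perm⁻¹ i))⁻¹ := rfl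
@[simp] theorem inv_aut (p : SemilinMonomial F n) : p⁻¹.aut = p.aut⁻¹ := rfl

instance : Group (SemilinMonomial F n) :=
  Group.ofLeftAxioms
    (fun p r s => by
      ext <;> simp [mul_assoc])
    (fun p => by ext <;> simp)
    (fun p => by
      ext
      · simp
      · simp
      · simp)

instance [Finite F] : Finite (SemilinMonomial F n) := by
  have : Finite (F ≃+* F) := Finite.of_injective (fun e : F ≃+* F => (e : F → F))
    DFunLike.coe_injective
  exact Finite.of_equiv _ (equivProd F n).symm

theorem card_eq [Finite F] : Nat.card (SemilinMonomial F n) =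
    n ! * ((Nat.card F - 1) ^ n * Nat.card (F ≃+* F)) := by
  rw [Nat.card_congr (equivProd F n), Nat.card_prod, Nat.card_prod, Nat.card_perm, Nat.card_fun,
    Nat.card_units, Nat.card_fin]

/-- The map given by the data. -/
def toLin (p : SemilinMonomial F n) : (Fin n → F) →ₛₗ[(p.aut : F →+* F)] (Fin n → F) where
  toFun x i := p.diag i * p.aut (x (p.perm i))
  map_add' x y := by ext i; simp [mul_add]
  map_smul' c x := by ext i; simp [mul_left_comm]

theorem toLin_apply (p : SemilinMonomial F n) (x : Fin n → F) (i : Fin n) :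
    p.toLin x i = p.diag i * p.aut (x (p.perm i)) := rfl

theorem toLin_one (x : Fin n → F) : (1 : SemilinMonomial F n).toLin x = x := by
  ext i
  rw [toLin_apply]
  simp

theorem toLin_mul (p r : SemilinMonomial F n) (x : Fin n → F) :
    (p * r).toLin x = p.toLin (r.toLin x) := by
  ext i
  simp only [toLin_apply]
  simp [mul_assoc]

theorem toLin_injective (p : SemilinMonomial F n) : Function.Injective p.toLin := by
  intro x y h
  rw [← toLin_one x, ← inv_mul_cancel p, toLin_mul, h, ← toLin_mul, inv_mul_cancel, toLin_one]

instance : MulAction (SemilinMonomial F n) (LinCode F n) where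
  smul p C := C.map p.toLin
  one_smul C := by
    refine SetLike.coe_injective ?_
    change (1 : SemilinMonomial F n).toLin '' _ = _
    simp only [toLin_one, Set.image_id']
  mul_smul p r C := by
    refine SetLike.coe_injective ?_
    change (p * r).toLin '' _ = p.toLin '' (r.toLin '' _)
    rw [Set.image_image]
    simp only [toLin_mul]

theorem coe_smul (p : SemilinMonomial F n) (C : LinCode F n) :
    ((p • C : LinCode F n) : Set (Fin n → F)) = p.toLin '' C := rfl

theorem smul_eq_iff (p : SemilinMonomial F n) (C D : LinCode F n) :
    p • C = D ↔ (fun (x : Fin n → F) i => (p.diag i : F) * p.aut (x (p.perm i))) ''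
      (C : Set (Fin n → F)) = (D : Set (Fin n → F)) := by
  rw [← SetLike.coe_set_eq, coe_smul]
  rfl

/-- The linear monomial maps. -/
def linear (F : Type*) [Field F] (n : ℕ) : Subgroup (SemilinMonomial F n) where
  carrier := {p | p.aut = 1}
  one_mem' := rfl
  mul_mem' {p r} hp hr := by
    change p.aut * r.aut = 1
    rw [show p.aut = 1 from hp, show r.aut = 1 from hr, mul_one]
  inv_mem' {p} hp := by
    change p.aut⁻¹ = 1
    rw [show p.aut = 1 from hp, inv_one]

/-- The permutations of the coordinates. -/
def permutations (F : Type*) [Field F] (n : ℕ) : Subgroup (SemilinMonomial F n) where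
  carrier := {p | p.diag = 1 ∧ p.aut = 1}
  one_mem' := ⟨rfl, rfl⟩
  mul_mem' {p r} hp hr := by
    constructor
    · ext i
      simp [hp.1, hr.1]
    · simp [hp.2, hr.2]
  inv_mem' {p} hp := by
    constructor
    · ext i
      simp [hp.1]
    · simp [hp.2]

theorem mem_linear {p : SemilinMonomial F n} : p ∈ linear F n ↔ p.aut = 1 := Iff.rfl

theorem card_linear [Finite F] : Nat.card (linear F n) = n ! * (Nat.card F - 1) ^ n := by
  have e : linear F n ≃ Equiv.Perm (Fin n) × (Fin n → Fˣ) :=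
    { toFun := fun p => (p.1.perm, p.1.diag)
      invFun := fun x => ⟨⟨x.1, x.2, 1⟩, rfl⟩
      left_inv := fun p => Subtype.ext (SemilinMonomial.ext rfl rfl (mem_linear.1 p.2).symm)
      right_inv := fun _ => rfl }
  rw [Nat.card_congr e, Nat.card_prod, Nat.card_perm, Nat.card_fun, Nat.card_units, Nat.card_fin]

theorem card_permutations : Nat.card (permutations F n) = n ! := by
  have e : permutations F n ≃ Equiv.Perm (Fin n) :=
    { toFun := fun p => p.1.perm
      invFun := fun x => ⟨⟨x, 1, 1⟩, rfl, rfl⟩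
      left_inv := fun p => Subtype.ext (SemilinMonomial.ext rfl p.2.1.symm p.2.2.symm)
      right_inv := fun _ => rfl }
  rw [Nat.card_congr e, Nat.card_perm, Nat.card_fin]

/-- The number of orbits of a subgroup on the codes. -/
noncomputable def numOrbits (H : Subgroup (SemilinMonomial F n)) : ℕ :=
  Nat.card (MulAction.orbitRel.Quotient H (LinCode F n))

theorem numOrbits_eq (H : Subgroup (SemilinMonomial F n)) (s : Setoid (LinCode F n))
    (h : ∀ C D, s C D ↔ ∃ p ∈ H, p • C = D) : numOrbits H = Nat.card (Quotient s) := by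
  refine Nat.card_congr (Quotient.congrRight fun C D => ?_)
  rw [h]
  change C ∈ MulAction.orbit H D ↔ _
  rw [MulAction.mem_orbit_iff]
  constructor
  · rintro ⟨⟨p, hp⟩, rfl⟩
    exact ⟨p⁻¹, H.inv_mem hp, inv_smul_smul p D⟩
  · rintro ⟨p, hp, rfl⟩
    exact ⟨⟨p⁻¹, H.inv_mem hp⟩, inv_smul_smul p C⟩

theorem numPerm_eq : numPerm F n = numOrbits (permutations F n) := by
  refine (numOrbits_eq _ _ fun C D => ?_).symm
  constructor
  · rintro ⟨σ, h⟩
    exact ⟨⟨σ, 1, 1⟩, ⟨rfl, rfl⟩, (smul_eq_iff _ _ _).2 (by simpa using h)⟩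
  · rintro ⟨p, hp, h⟩
    refine ⟨p.perm, ?_⟩
    rw [smul_eq_iff, hp.1, hp.2] at h
    simpa using h

theorem numMonomial_eq : numMonomial F n = numOrbits (linear F n) := by
  refine (numOrbits_eq _ _ fun C D => ?_).symm
  constructor
  · rintro ⟨σ, d, h⟩
    exact ⟨⟨σ, d, 1⟩, rfl, (smul_eq_iff _ _ _).2 (by simpa using h)⟩
  · rintro ⟨p, hp, h⟩
    refine ⟨p.perm, p.diag, ?_⟩
    rw [smul_eq_iff, mem_linear.1 hp] at h
    simpa using h

theorem numSemilinear_eq : numSemilinear F n = numOrbits (⊤ : Subgroup (SemilinMonomial F n)) := by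
  refine (numOrbits_eq _ _ fun C D => ?_).symm
  constructor
  · rintro ⟨σ, d, τ, h⟩
    exact ⟨⟨σ, d, τ⟩, trivial, (smul_eq_iff _ _ _).2 h⟩
  · rintro ⟨p, -, h⟩
    exact ⟨p.perm, p.diag, p.aut, (smul_eq_iff _ _ _).1 h⟩

/-- The multiplication by one scalar. -/
def scalar (n : ℕ) (c : Fˣ) : SemilinMonomial F n := ⟨1, fun _ => c, 1⟩

theorem scalar_smul (c : Fˣ) (C : LinCode F n) : scalar n c • C = C := by
  refine SetLike.coe_injective ?_
  rw [coe_smul]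
  have h : ∀ x, (scalar n c).toLin x = (c : F) • x := fun x => by
    ext i
    rw [toLin_apply]
    simp [scalar]
  ext x
  simp only [Set.mem_image, h, SetLike.mem_coe]
  constructor
  · rintro ⟨y, hy, rfl⟩
    exact C.smul_mem _ hy
  · exact fun hx => ⟨(c⁻¹ : Fˣ) • x, C.smul_mem _ hx, smul_inv_smul c x⟩

/-- The number of codes fixed by `p`. -/
noncomputable def numFixed (p : SemilinMonomial F n) : ℕ :=
  Nat.card {C : LinCode F n // p • C = C}

open Classical in
/-- The number of pairs of a code and a non-scalar map which fixes it. -/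
noncomputable def numFixedNonscalar (F : Type*) [Field F] [Finite F] (n : ℕ) : ℕ :=
  letI := Fintype.ofFinite (SemilinMonomial F n)
  ∑ p : SemilinMonomial F n with p ∉ Set.range (scalar n), numFixed p

-- Burnside's lemma: scalars fix every code, and the other elements of `H` are bounded by those of
-- the whole group, so that one error term serves all three equivalences.
open Classical in
theorem numOrbits_mul_card [Finite F] (H : Subgroup (SemilinMonomial F n)) :
    (Nat.card {p // p ∈ H ∧ p ∈ Set.range (scalar (F := F) n)}) * Nat.card (LinCode F n) ≤
      numOrbits H * Nat.card H ∧
    numOrbits H * Nat.card H ≤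
      (Nat.card {p // p ∈ H ∧ p ∈ Set.range (scalar (F := F) n)}) * Nat.card (LinCode F n) +
        numFixedNonscalar F n := by
  let _ := Fintype.ofFinite (SemilinMonomial F n)
  let _ := Fintype.ofFinite (LinCode F n)
  have hb := MulAction.sum_card_fixedBy_eq_card_orbits_mul_card_group H (LinCode F n)
  rw [← Nat.card_eq_fintype_card, ← Nat.card_eq_fintype_card] at hb
  have h1 : ∑ h : H, Fintype.card (MulAction.fixedBy (LinCode F n) h) =
      ∑ p : SemilinMonomial F n with p ∈ H, numFixed p := by
    rw [← Finset.sum_subtype_eq_sum_filter, Finset.subtype_univ]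
    refine Finset.sum_congr rfl fun h _ => ?_
    rw [← Nat.card_eq_fintype_card]
    rfl
  have h2 : ∑ p : SemilinMonomial F n with p ∈ H ∧ p ∈ Set.range (scalar n), numFixed p =
      (Nat.card {p // p ∈ H ∧ p ∈ Set.range (scalar (F := F) n)}) * Nat.card (LinCode F n) := by
    rw [Finset.sum_congr rfl (g := fun _ => Nat.card (LinCode F n)), Finset.sum_const,
      smul_eq_mul, Nat.card_eq_fintype_card (α := {p // _}), Fintype.card_subtype]
    intro p hp
    obtain ⟨-, -, c, rfl⟩ := Finset.mem_filter.1 hp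
    exact Nat.card_congr (Equiv.subtypeUnivEquiv fun C => scalar_smul c C)
  have h3 : numOrbits H * Nat.card H = ∑ p : SemilinMonomial F n with p ∈ H, numFixed p :=
    hb.symm.trans h1
  rw [h3, ← h2, ← Finset.sum_filter_add_sum_filter_not
    (Finset.univ.filter fun p => p ∈ H) (fun p => p ∈ Set.range (scalar n)),
    Finset.filter_filter, Finset.filter_filter]
  refine ⟨Nat.le_add_right _ _, Nat.add_le_add_left ?_ _⟩
  refine Finset.sum_le_sum_of_subset fun p hp => ?_
  simp only [Finset.mem_filter, Finset.mem_univ, true_and] at hp ⊢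
  exact hp.2

theorem scalar_injective (hn : n ≠ 0) : Function.Injective (scalar (F := F) n) := by
  intro c c' h
  exact congrFun (congrArg diag h) ⟨0, Nat.pos_of_ne_zero hn⟩

theorem card_scalar_mem [Finite F] (hn : n ≠ 0) (H : Subgroup (SemilinMonomial F n))
    (hH : linear F n ≤ H) :
    Nat.card {p // p ∈ H ∧ p ∈ Set.range (scalar (F := F) n)} = Nat.card F - 1 := by
  rw [← Nat.card_units, Nat.card_congr (Equiv.ofInjective _ (scalar_injective (F := F) hn))]
  refine Nat.card_congr (Equiv.subtypeEquivRight fun p => ?_)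
  constructor
  · exact fun h => h.2
  · rintro ⟨c, rfl⟩
    exact ⟨hH rfl, c, rfl⟩

theorem card_scalar_mem_permutations :
    Nat.card {p // p ∈ permutations F n ∧ p ∈ Set.range (scalar (F := F) n)} = 1 := by
  have : Unique {p // p ∈ permutations F n ∧ p ∈ Set.range (scalar (F := F) n)} :=
    { default := ⟨1, one_mem _, 1, rfl⟩
      uniq := by
        rintro ⟨p, hp, c, rfl⟩
        exact Subtype.ext (SemilinMonomial.ext rfl hp.1 rfl) }
  exact Nat.card_unique

end SemilinMonomial
-- Fixed codes of a single map, and the number of maps close to a scalar.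
namespace SemilinMonomial

open Module

variable {F : Type*} [Field F] {n : ℕ}

/-- The linear monomial map with the permutation and the coefficients of `p`. -/
def linMap (p : SemilinMonomial F n) : (Fin n → F) →ₗ[F] (Fin n → F) where
  toFun x i := p.diag i * x (p.perm i)
  map_add' x y := by ext i; simp [mul_add]
  map_smul' c x := by ext i; simp [mul_left_comm]

theorem linMap_apply (p : SemilinMonomial F n) (x : Fin n → F) (i : Fin n) :
    p.linMap x i = p.diag i * x (p.perm i) := rfl

theorem toLin_eq_linMap {p : SemilinMonomial F n} (hp : p.aut = 1) (x : Fin n → F) :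
    p.toLin x = p.linMap x := by
  ext i
  rw [toLin_apply, linMap_apply, hp, RingAut.one_apply]

open Classical in
/-- The coordinates at which `p` differs from the multiplication by `c`. -/
noncomputable def moved (p : SemilinMonomial F n) (c : Fˣ) : Finset (Fin n) :=
  {i | ¬ (p.perm i = i ∧ p.diag i = c)}

theorem mem_moved {p : SemilinMonomial F n} {c : Fˣ} {i : Fin n} :
    i ∈ p.moved c ↔ ¬ (p.perm i = i ∧ p.diag i = c) := by
  simp [moved]

theorem mem_ker_linMap_sub {p : SemilinMonomial F n} {c : F} {x : Fin n → F} :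
    x ∈ LinearMap.ker (p.linMap - c • LinearMap.id) ↔
      ∀ i, (p.diag i : F) * x (p.perm i) = c * x i := by
  rw [LinearMap.mem_ker, funext_iff]
  simp [linMap_apply, sub_eq_zero]

/-- A linear monomial map differs from a multiplication by a scalar in at most twice as many
coordinates as the rank of the difference. -/
theorem card_moved_le (p : SemilinMonomial F n) (c : Fˣ) :
    (p.moved c).card ≤ 2 * finrank F (LinearMap.range (p.linMap - (c : F) • LinearMap.id)) := by
  classical
  set K := LinearMap.ker (p.linMap - (c : F) • LinearMap.id) with hK
  have hrn := (p.linMap - (c : F) • LinearMap.id).finrank_range_add_finrank_ker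
  rw [finrank_fin_fun, ← hK] at hrn
  let P : Finset (Fin n) → Prop := fun B => ∀ x ∈ K, (∀ i ∈ B, x i = 0) → x = 0
  -- `B` is a minimal set of coordinates that determines the vectors of the eigenspace `K`. Hence
  -- `dim K ≤ |B|`, and the complement of `B` has at most as many elements as the rank.
  obtain ⟨B, hB, hmin⟩ : ∃ B, P B ∧ ∀ i ∈ B, ¬ P (B.erase i) := by
    obtain ⟨B, hB⟩ := Set.Finite.exists_minimal (Set.toFinite {B | P B})
      ⟨Finset.univ, fun x _ h => funext fun i => h i (Finset.mem_univ i)⟩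
    refine ⟨B, hB.prop, fun i hi h => ?_⟩
    exact Finset.notMem_erase i B (hB.le_of_le h (Finset.erase_subset i B) hi)
  have hdim : finrank F K ≤ B.card := by
    let f : K →ₗ[F] (B → F) := (LinearMap.funLeft F F (fun i : B => (i : Fin n))).comp K.subtype
    have hf : Function.Injective f := by
      rw [← LinearMap.ker_eq_bot, LinearMap.ker_eq_bot']
      intro x hx
      exact Subtype.ext (hB x x.2 fun i hi => congrFun hx ⟨i, hi⟩)
    simpa using LinearMap.finrank_le_finrank_of_injective hf
  -- Otherwise the eigenvalue equation at `i` makes a coordinate of `B` superfluous: `x i = 0` is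
  -- forced if `i` is a fixed point with coefficient other than `c`, and if not, `x i = 0` forces `x
  -- (p.perm i) = 0`. So the moved coordinates inside `B` inject into the complement of `B`.
  have hmoved : ∀ i ∈ B, i ∈ p.moved c → p.perm i ∈ Bᶜ := by
    intro i hi hm
    rw [Finset.mem_compl]
    intro hi'
    by_cases h : p.perm i = i
    · refine hmin i hi fun x hx h0 => hB x hx fun j hj => ?_
      by_cases hji : j = i
      · subst hji
        have := mem_ker_linMap_sub.1 hx j
        rw [h] at this
        by_contra hne
        exact mem_moved.1 hm ⟨h, Units.ext (mul_right_cancel₀ hne this)⟩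
      · exact h0 j (Finset.mem_erase.2 ⟨hji, hj⟩)
    · refine hmin _ hi' fun x hx h0 => hB x hx fun j hj => ?_
      by_cases hji : j = p.perm i
      · have := mem_ker_linMap_sub.1 hx i
        rw [h0 i (Finset.mem_erase.2 ⟨Ne.symm h, hi⟩), mul_zero] at this
        rw [hji]
        exact (mul_eq_zero.1 this).resolve_left (Units.ne_zero _)
      · exact h0 j (Finset.mem_erase.2 ⟨hji, hj⟩)
  have h1 : (p.moved c ∩ B).card ≤ Bᶜ.card :=
    Finset.card_le_card_of_injOn p.perm (fun i hi => by
      have hi := Finset.mem_inter.1 hi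
      exact hmoved i hi.2 hi.1) p.perm.injective.injOn
  have h2 : (p.moved c \ B).card ≤ Bᶜ.card :=
    Finset.card_le_card fun i hi => Finset.mem_compl.2 (Finset.mem_sdiff.1 hi).2
  have h3 := Finset.card_inter_add_card_sdiff (p.moved c) B
  have h4 : Bᶜ.card = n - B.card := by rw [Finset.card_compl, Fintype.card_fin]
  omega

/-- A linear monomial map is determined by its action on the coordinates at which it differs
from a scalar. -/
theorem card_moved_le_pow [Finite F] (c : Fˣ) (m : ℕ) :
    Nat.card {p : SemilinMonomial F n //
      p.aut = 1 ∧ p ∉ Set.range (scalar n) ∧ (p.moved c).card ≤ m} ≤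
      (n ^ 2 * Nat.card F) ^ m := by
  classical
  have hex : ∀ p : {p : SemilinMonomial F n //
      p.aut = 1 ∧ p ∉ Set.range (scalar n) ∧ (p.moved c).card ≤ m},
      ∃ s : Fin m → Fin n, ∀ i, i ∈ p.1.moved c ↔ i ∈ Set.range s := by
    rintro ⟨p, h1, h2, h3⟩
    have hne : (p.moved c).Nonempty := by
      rw [Finset.nonempty_iff_ne_empty]
      intro he
      have h : ∀ i, p.perm i = i ∧ p.diag i = c := fun i => by
        by_contra hi
        have := mem_moved.2 hi
        simp [he] at this
      exact h2 ⟨c, SemilinMonomial.ext (Equiv.ext fun i => ((h i).1).symm)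
        (funext fun i => (h i).2.symm) h1.symm⟩
    obtain ⟨a, ha⟩ := hne
    let e := (p.moved c).equivFin
    -- The moved set is listed as a sequence of length exactly `m`, padded by a moved coordinate
    -- `a`, which exists because `p` is not a scalar.
    refine ⟨fun j => if hj : (j : ℕ) < (p.moved c).card then (e.symm ⟨j, hj⟩ : Fin n) else a,
      fun i => ⟨fun hi => ?_, ?_⟩⟩
    · refine ⟨⟨e ⟨i, hi⟩, (e ⟨i, hi⟩).2.trans_le h3⟩, ?_⟩
      simp
    · rintro ⟨j, rfl⟩
      dsimp only
      split_ifs with hj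
      · exact (e.symm ⟨j, hj⟩).2
      · exact ha
  choose s hs using hex
  let f : {p : SemilinMonomial F n //
      p.aut = 1 ∧ p ∉ Set.range (scalar n) ∧ (p.moved c).card ≤ m} →
      (Fin m → Fin n × Fin n × Fˣ) := fun p j =>
    (s p j, p.1.perm (s p j), p.1.diag (s p j))
  have hf : Function.Injective f := by
    intro p r h
    have hsr : s p = s r := funext fun j => congrArg Prod.fst (congrFun h j)
    have key : ∀ i, p.1.perm i = r.1.perm i ∧ p.1.diag i = r.1.diag i := by
      intro i
      by_cases hi : i ∈ p.1.moved c
      · obtain ⟨j, rfl⟩ := (hs p i).1 hi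
        have h2 := congrArg Prod.snd (congrFun h j)
        have h3 := congrArg Prod.fst h2
        have h4 := congrArg Prod.snd h2
        simp only [f, ← hsr] at h3 h4
        exact ⟨h3, h4⟩
      · have hi' : i ∉ r.1.moved c := by rwa [hs r, ← hsr, ← hs p]
        rw [mem_moved, not_not] at hi hi'
        exact ⟨hi.1.trans hi'.1.symm, hi.2.trans hi'.2.symm⟩
    exact Subtype.ext (SemilinMonomial.ext (Equiv.ext fun i => (key i).1)
      (funext fun i => (key i).2) (p.2.1.trans r.2.1.symm))
  refine (Nat.card_le_card_of_injective f hf).trans ?_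
  rw [Nat.card_fun, Nat.card_prod, Nat.card_prod, Nat.card_fin, Nat.card_fin, ← mul_assoc, ← sq,
    Nat.card_units]
  exact Nat.pow_le_pow_left (Nat.mul_le_mul_left _ (Nat.sub_le _ _)) _

variable [Finite F]

theorem numFixed_le_card_stable (p : SemilinMonomial F n) :
    p.numFixed ≤ Nat.card {W : LinCode F n // IsStableUnder p.toLin W} := by
  refine Nat.card_le_card_of_injective (fun C => ⟨C.1, fun w hw => ?_⟩) fun C D h =>
    Subtype.ext (Subtype.mk.inj h)
  have h : p.toLin w ∈ ((p • C.1 : LinCode F n) : Set (Fin n → F)) :=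
    (coe_smul p C.1) ▸ Set.mem_image_of_mem _ hw
  rwa [C.2] at h

theorem numFixed_le_of_aut_ne_one {p : SemilinMonomial F n} (hp : p.aut ≠ 1) :
    p.numFixed ≤ (n + 1) * Nat.card F ^ ((n + 4 + 2) ^ 2 / 8) := by
  obtain ⟨a, ha⟩ : ∃ a, p.aut a ≠ a := by
    by_contra! h
    exact hp (RingEquiv.ext h)
  refine p.numFixed_le_card_stable.trans ?_
  have := card_invariant_le_of_semilinear (τ := (p.aut : F →+* F)) ha p.toLin_injective
  rwa [finrank_fin_fun] at this

theorem numFixed_le_of_eigenspaces {p : SemilinMonomial F n} (hp : p.aut = 1) {e : ℕ}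
    (he : ∀ c : Fˣ, finrank F (LinearMap.ker (p.linMap - (c : F) • LinearMap.id)) ≤ e) :
    p.numFixed ≤ (n + 1) * Nat.card F ^ ((n + (e + 2) + 2) ^ 2 / 8) := by
  refine p.numFixed_le_card_stable.trans ?_
  rw [show (p.toLin : (Fin n → F) → (Fin n → F)) = p.linMap from funext (toLin_eq_linMap hp)]
  have := card_invariant_le_of_eigenspaces p.linMap (e := e) fun c => by
    -- The value `c = 0` is not covered by the hypothesis, but a monomial map is injective.
    by_cases hc : c = 0
    · have h : LinearMap.ker (p.linMap - c • LinearMap.id) = ⊥ := by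
        rw [hc, zero_smul, sub_zero, LinearMap.ker_eq_bot]
        intro x y h
        rw [← toLin_eq_linMap hp, ← toLin_eq_linMap hp] at h
        exact p.toLin_injective h
      rw [h, finrank_bot]
      exact Nat.zero_le _
    · exact he (Units.mk0 c hc)
  rwa [finrank_fin_fun] at this

/-- A subspace stable under `p` is stable under `p - c`, whose kernel is the eigenspace, so
`card_invariant_le_mul` applies to the difference. -/
theorem numFixed_le_mul {p : SemilinMonomial F n} (hp : p.aut = 1) (c : F) :
    p.numFixed ≤
      Nat.card (LinCode F (finrank F (LinearMap.range (p.linMap - c • LinearMap.id)))) *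
      Nat.card (LinCode F (finrank F (LinearMap.ker (p.linMap - c • LinearMap.id)))) := by
  refine p.numFixed_le_card_stable.trans (le_trans ?_ (card_invariant_le_mul _))
  refine Nat.card_le_card_of_injective (fun W => ⟨W.1, ?_⟩) fun C D h =>
    Subtype.ext (congrArg Subtype.val h :)
  rintro _ ⟨w, hw, rfl⟩
  have h := W.2 w hw
  rw [toLin_eq_linMap hp] at h
  simpa using W.1.sub_mem h (W.1.smul_mem c hw)

end SemilinMonomial
-- The order of the automorphism group and the analytic limits.
-- Every automorphism fixes the prime field, and a finite field is Galois over it, so the order is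
-- the degree.
theorem card_ringAut_eq_logb {F : Type*} [Field F] [Finite F] (p : ℕ) (hp : p = ringChar F) :
    (Nat.card (F ≃+* F) : ℝ) = Real.logb p (Nat.card F) := by
  have hprime : Fact p.Prime := ⟨hp ▸ CharP.char_is_prime F (ringChar F)⟩
  have : CharP F p := hp ▸ ringChar.charP F
  let _ : Algebra (ZMod p) F := ZMod.algebra F p
  have e : (F ≃+* F) ≃ (F ≃ₐ[ZMod p] F) :=
    { toFun := fun f => AlgEquiv.ofRingEquiv (f := f) fun x =>
        RingHom.congr_fun (Subsingleton.elim
          ((f : F →+* F).comp (algebraMap (ZMod p) F)) (algebraMap (ZMod p) F)) x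
      invFun := fun f => f.toRingEquiv
      left_inv := fun f => by ext; rfl
      right_inv := fun f => by ext; rfl }
  rw [Nat.card_congr e, IsGalois.card_aut_eq_finrank,
    Module.natCard_eq_pow_finrank (K := ZMod p) (V := F), Nat.card_zmod, Nat.cast_pow,
    Real.logb_pow, Real.logb_self_eq_one (by exact_mod_cast hprime.out.one_lt), mul_one]

/-- The quotient of the two sides lies between `1` and `1 + E/G`, the latter because `z ≥ 1`. -/
theorem isEquivalent_of_mul_le {N h z G E : ℕ → ℕ} (hh : ∀ᶠ n in atTop, 0 < h n)
    (hz : ∀ᶠ n in atTop, 0 < z n) (hG : ∀ᶠ n in atTop, 0 < G n)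
    (hl : ∀ᶠ n in atTop, z n * G n ≤ N n * h n)
    (hu : ∀ᶠ n in atTop, N n * h n ≤ z n * G n + E n)
    (hE : Tendsto (fun n => (E n : ℝ) / G n) atTop (nhds 0)) :
    (fun n => (N n : ℝ)) ~[atTop] fun n => (z n : ℝ) * G n / h n := by
  refine isEquivalent_of_tendsto_one ?_
  have h1 : Tendsto (fun n => 1 + (E n : ℝ) / G n) atTop (nhds 1) := by
    simpa using hE.const_add 1
  refine tendsto_of_tendsto_of_tendsto_of_le_of_le' tendsto_const_nhds h1 ?_ ?_
  · filter_upwards [hh, hz, hG, hl] with n h1 h2 h3 h4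
    have h1 : (0 : ℝ) < h n := by exact_mod_cast h1
    have h2 : (0 : ℝ) < z n := by exact_mod_cast h2
    have h3 : (0 : ℝ) < G n := by exact_mod_cast h3
    have h4 : (z n : ℝ) * G n ≤ N n * h n := by exact_mod_cast h4
    rw [Pi.div_apply, le_div_iff₀ (by positivity), one_mul, div_le_iff₀ h1]
    exact h4
  · filter_upwards [hh, hz, hG, hu] with n h1 h2 h3 h4
    have h1 : (0 : ℝ) < h n := by exact_mod_cast h1
    have h2 : (1 : ℝ) ≤ z n := by exact_mod_cast h2
    have h3 : (0 : ℝ) < G n := by exact_mod_cast h3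
    have h4 : (N n : ℝ) * h n ≤ z n * G n + E n := by exact_mod_cast h4
    have hE0 : (0 : ℝ) ≤ E n := Nat.cast_nonneg _
    rw [Pi.div_apply, div_le_iff₀ (by positivity), ← mul_div_assoc, le_div_iff₀ h1]
    refine h4.trans ?_
    have h5 : (1 + (E n : ℝ) / G n) * (z n * G n) = z n * G n + z n * E n := by
      field_simp
    rw [h5]
    nlinarith

theorem tendsto_pow_div_pow_floor {q : ℕ} (hq : 2 ≤ q) (k : ℕ) :
    Tendsto (fun n : ℕ => ((n : ℝ) + 1) ^ k / (q : ℝ) ^ (n / 32)) atTop (nhds 0) := by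
  have hq' : (1 : ℝ) < q := by exact_mod_cast hq
  have hdiv : Tendsto (fun n : ℕ => n / 32 + 1) atTop atTop :=
    (tendsto_add_atTop_nat 1).comp (Nat.tendsto_div_const_atTop (by norm_num))
  have h := ((tendsto_pow_const_div_const_pow_of_one_lt k hq').comp hdiv).const_mul
    ((32 : ℝ) ^ k * q)
  rw [mul_zero] at h
  refine squeeze_zero (fun n => by positivity) (fun n => ?_) h
  have h1 : (n : ℝ) + 1 ≤ 32 * ((n / 32 + 1 : ℕ) : ℝ) := by
    have : n + 1 ≤ 32 * (n / 32 + 1) := by omega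
    exact_mod_cast this
  have hq0 : (0 : ℝ) < q := by linarith
  calc ((n : ℝ) + 1) ^ k / (q : ℝ) ^ (n / 32)
      ≤ (32 * ((n / 32 + 1 : ℕ) : ℝ)) ^ k / (q : ℝ) ^ (n / 32) := by gcongr
    _ = _ := by
      simp only [Function.comp_apply]
      rw [mul_pow, pow_succ (q : ℝ) (n / 32)]
      field_simp

/-! ### The non-scalar maps contribute a negligible number of fixed codes. -/

namespace SemilinMonomial

open Module

/-- With eigenspaces of dimension at most `n/4` the exponent is about `(5n/4)²/8 = 25n²/128`. The
group order and one spare factor cost at most about `n²/32 = 4n²/128`, and `29/128 < 1/4` leaves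
room for the linear terms once `n ≥ 64`. -/
theorem exponent_bound {n : ℕ} (hn : 64 ≤ n) :
    (n + 1) * (n / 32) + (n + (n / 4 + 2) + 2) ^ 2 / 8 ≤ n ^ 2 / 4 := by
  have h1 : 32 * (n / 32) ≤ n := Nat.mul_div_le n 32
  have h2 : 4 * (n / 4) ≤ n := Nat.mul_div_le n 4
  set m := n / 32
  set u := n / 4
  have h3 : 8 * ((n + (u + 2) + 2) ^ 2 / 8) ≤ (n + (u + 2) + 2) ^ 2 := Nat.mul_div_le _ 8
  have h4 : 16 * (n + (u + 2) + 2) ^ 2 ≤ (5 * n + 16) ^ 2 := by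
    rw [show 16 = 4 ^ 2 by norm_num, ← mul_pow]
    exact Nat.pow_le_pow_left (by omega) 2
  have h5 : 32 * ((n + 1) * m) ≤ (n + 1) * n := by nlinarith
  rw [Nat.le_div_iff_mul_le (by norm_num)]
  nlinarith

/-- With `e = n - r`, splitting `n = r + e` saves `re/2` in the exponent, and `n < 4e` gives `8
(n/32) ≤ e`, so the saving is at least `4r (n/32)`. -/
theorem exponent_bound_mul {r n : ℕ} (hr : r ≤ n) (h : n < 4 * (n - r)) :
    r ^ 2 / 4 + (n - r) ^ 2 / 4 + 4 * r * (n / 32) ≤ n ^ 2 / 4 := by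
  obtain ⟨e, rfl⟩ := Nat.exists_eq_add_of_le hr
  rw [Nat.add_sub_cancel_left] at *
  rw [Nat.le_div_iff_mul_le (by norm_num)]
  have h1 : 32 * ((r + e) / 32) ≤ r + e := Nat.mul_div_le _ 32
  have h2 : 4 * (r ^ 2 / 4) ≤ r ^ 2 := Nat.mul_div_le _ 4
  have h3 : 4 * (e ^ 2 / 4) ≤ e ^ 2 := Nat.mul_div_le _ 4
  set m := (r + e) / 32
  have h4 : 8 * m ≤ e := by omega
  nlinarith [Nat.mul_le_mul_left r h4]

variable {F : Type*} [Field F] [Finite F] {n : ℕ}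

theorem card_mul_card_mul_le {r : ℕ} (hr : r ≤ n) (h : n < 4 * (n - r)) :
    Nat.card (LinCode F r) * Nat.card (LinCode F (n - r)) * (Nat.card F ^ (n / 32)) ^ (4 * r) ≤
      (n + 1) ^ 4 * Nat.card (LinCode F n) := by
  calc Nat.card (LinCode F r) * Nat.card (LinCode F (n - r)) *
        (Nat.card F ^ (n / 32)) ^ (4 * r)
      ≤ ((n + 1) ^ 2 * Nat.card F ^ (r ^ 2 / 4)) *
        ((n + 1) ^ 2 * Nat.card F ^ ((n - r) ^ 2 / 4)) * (Nat.card F ^ (n / 32)) ^ (4 * r) := by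
        refine Nat.mul_le_mul_right _ (Nat.mul_le_mul ?_ ?_)
        · exact (card_linCode_le r).trans (Nat.mul_le_mul_right _
            (Nat.pow_le_pow_left (by omega) 2))
        · exact (card_linCode_le (n - r)).trans (Nat.mul_le_mul_right _
            (Nat.pow_le_pow_left (by omega) 2))
    _ = (n + 1) ^ 4 *
        Nat.card F ^ (r ^ 2 / 4 + (n - r) ^ 2 / 4 + 4 * r * (n / 32)) := by
        rw [← pow_mul, pow_add, pow_add, mul_comm (n / 32)]; ring
    _ ≤ _ := Nat.mul_le_mul_left _ ((Nat.pow_le_pow_right Nat.card_pos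
        (exponent_bound_mul hr h)).trans (pow_le_card_linCode n))

-- The first term covers a nontrivial field automorphism and the linear maps with all eigenspaces of
-- dimension at most `n/4`. The double sum covers the rest: `c` has a larger eigenspace and `r` is
-- the rank of `p - c`, which is positive since `p` is not a scalar.
open Classical in
theorem numFixed_le_add_sum [Fintype Fˣ] (hn : 8 ≤ n) {p : SemilinMonomial F n}
    (hp : p ∉ Set.range (scalar n)) :
    p.numFixed ≤ (n + 1) * Nat.card F ^ ((n + (n / 4 + 2) + 2) ^ 2 / 8) +
      ∑ c : Fˣ, ∑ r ∈ Finset.range (n + 1), if 1 ≤ r ∧ n < 4 * (n - r) then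
        if p.aut = 1 ∧ p ∉ Set.range (scalar n) ∧ (p.moved c).card ≤ 2 * r then
          Nat.card (LinCode F r) * Nat.card (LinCode F (n - r)) else 0 else 0 := by
  by_cases ha : p.aut = 1
  · by_cases he : ∀ c : Fˣ, finrank F (LinearMap.ker (p.linMap - (c : F) • LinearMap.id)) ≤ n / 4
    · exact (numFixed_le_of_eigenspaces ha he).trans (Nat.le_add_right _ _)
    · push Not at he
      obtain ⟨c, hc⟩ := he
      have hm := card_moved_le p c
      have hrn := (p.linMap - (c : F) • LinearMap.id).finrank_range_add_finrank_ker
      rw [finrank_fin_fun] at hrn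
      have hf := numFixed_le_mul ha (c : F)
      have hr1 : 1 ≤ finrank F (LinearMap.range (p.linMap - (c : F) • LinearMap.id)) := by
        by_contra h0
        have hempty : p.moved c = ∅ := Finset.card_eq_zero.1 (by omega)
        have h : ∀ i, p.perm i = i ∧ p.diag i = c := fun i => by
          by_contra hi
          have := mem_moved.2 hi
          simp [hempty] at this
        exact hp ⟨c, SemilinMonomial.ext (Equiv.ext fun i => ((h i).1).symm)
          (funext fun i => (h i).2.symm) ha.symm⟩
      generalize finrank F (LinearMap.range (p.linMap - (c : F) • LinearMap.id)) = r at *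
      generalize finrank F (LinearMap.ker (p.linMap - (c : F) • LinearMap.id)) = e at *
      obtain rfl : e = n - r := by omega
      refine (hf.trans ?_).trans (Nat.le_add_left _ _)
      refine le_trans ?_ (Finset.single_le_sum (fun _ _ => Nat.zero_le _) (Finset.mem_univ c))
      refine le_trans ?_ (Finset.single_le_sum (fun _ _ => Nat.zero_le _)
        (Finset.mem_range.2 (show r < n + 1 by omega)))
      rw [if_pos ⟨hr1, by omega⟩, if_pos ⟨ha, hp, hm⟩]
  · refine ((numFixed_le_of_aut_ne_one ha).trans ?_).trans (Nat.le_add_right _ _)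
    -- The semilinear bound has `4` where the other has `n / 4 + 2`; `8 ≤ n` makes the latter at
    -- least as large.
    exact Nat.mul_le_mul_left _ (Nat.pow_le_pow_right Nat.card_pos
      (Nat.div_le_div_right (Nat.pow_le_pow_left (by omega) 2)))

theorem numFixedNonscalar_le_sum [Fintype (SemilinMonomial F n)] (f : SemilinMonomial F n → ℕ)
    (hf : ∀ p ∉ Set.range (scalar n), p.numFixed ≤ f p) : numFixedNonscalar F n ≤ ∑ p, f p := by
  classical
  have h : numFixedNonscalar F n = ∑ p ∈ Finset.univ.filter
      (fun p : SemilinMonomial F n => p ∉ Set.range (scalar n)), p.numFixed := by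
    rw [numFixedNonscalar]
    congr!
  rw [h]
  exact (Finset.sum_le_sum fun p hp => hf p (Finset.mem_filter.1 hp).2).trans
    (Finset.sum_le_sum_of_subset (Finset.filter_subset _ _))

/-- `Q = q^(n/32)` eventually exceeds `n²q`, so the group has at most `Q^n |Aut(F)|` elements and
each pair `(c, r)` accounts for at most `Q^(2r)` maps. Both kinds of terms leave one factor `Q` to
spare, which beats the polynomial. -/
theorem mul_numFixedNonscalar_le (hn : 64 ≤ n)
    (hQ : n ^ 2 * Nat.card F ≤ Nat.card F ^ (n / 32)) :
    Nat.card F ^ (n / 32) * numFixedNonscalar F n ≤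
      (Nat.card (F ≃+* F) + Nat.card F) * (n + 1) ^ 5 * Nat.card (LinCode F n) := by
  classical
  let _ := Fintype.ofFinite (SemilinMonomial F n)
  let _ : Fintype Fˣ := Fintype.ofFinite Fˣ
  set Q := Nat.card F ^ (n / 32) with hQdef
  set B := (n + 1) * Nat.card F ^ ((n + (n / 4 + 2) + 2) ^ 2 / 8) with hB
  have hQ1 : 0 < Q := pow_pos Nat.card_pos _
  have h1 : numFixedNonscalar F n ≤ Nat.card (SemilinMonomial F n) * B +
      ∑ c : Fˣ, ∑ r ∈ Finset.range (n + 1), if 1 ≤ r ∧ n < 4 * (n - r) then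
        (n ^ 2 * Nat.card F) ^ (2 * r) *
          (Nat.card (LinCode F r) * Nat.card (LinCode F (n - r))) else 0 := by
    refine (numFixedNonscalar_le_sum _ fun p hp =>
      numFixed_le_add_sum (by omega) hp).trans ?_
    rw [Finset.sum_add_distrib, Finset.sum_const, Finset.card_univ, smul_eq_mul,
      ← Nat.card_eq_fintype_card]
    refine Nat.add_le_add_left ?_ _
    rw [Finset.sum_comm]
    refine Finset.sum_le_sum fun c _ => ?_
    rw [Finset.sum_comm]
    refine Finset.sum_le_sum fun r _ => ?_
    split_ifs with hr
    · rw [← Finset.sum_filter, Finset.sum_const, smul_eq_mul, ← Fintype.card_subtype,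
        ← Nat.card_eq_fintype_card]
      exact Nat.mul_le_mul_right _ (card_moved_le_pow c (2 * r))
    · simp
  have h2 : Q * (Nat.card (SemilinMonomial F n) * B) ≤
      Nat.card (F ≃+* F) * (n + 1) ^ 5 * Nat.card (LinCode F n) := by
    have hM : Nat.card (SemilinMonomial F n) ≤ Q ^ n * Nat.card (F ≃+* F) := by
      rw [card_eq, ← mul_assoc]
      refine Nat.mul_le_mul_right _ ?_
      calc n ! * (Nat.card F - 1) ^ n ≤ n ^ n * Nat.card F ^ n :=
            Nat.mul_le_mul (Nat.factorial_le_pow n) (Nat.pow_le_pow_left (Nat.sub_le _ _) n)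
        _ = (n * Nat.card F) ^ n := (mul_pow _ _ _).symm
        _ ≤ Q ^ n := Nat.pow_le_pow_left ((Nat.mul_le_mul_right _
            (Nat.le_self_pow two_ne_zero n)).trans hQ) n
    calc Q * (Nat.card (SemilinMonomial F n) * B)
        ≤ Q * (Q ^ n * Nat.card (F ≃+* F) * B) :=
          Nat.mul_le_mul_left _ (Nat.mul_le_mul_right _ hM)
      _ = Nat.card (F ≃+* F) * (n + 1) * Nat.card F ^ ((n + 1) * (n / 32) +
            (n + (n / 4 + 2) + 2) ^ 2 / 8) := by
          rw [pow_add, mul_comm (n + 1) (n / 32), pow_mul, ← hQdef, hB, pow_succ]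
          ring
      _ ≤ Nat.card (F ≃+* F) * (n + 1) ^ 5 * Nat.card (LinCode F n) :=
          Nat.mul_le_mul (Nat.mul_le_mul_left _ (Nat.le_self_pow (by norm_num) _))
            ((Nat.pow_le_pow_right Nat.card_pos (exponent_bound hn)).trans
              (pow_le_card_linCode n))
  have h3 : Q * ∑ c : Fˣ, ∑ r ∈ Finset.range (n + 1), (if 1 ≤ r ∧ n < 4 * (n - r) then
        (n ^ 2 * Nat.card F) ^ (2 * r) *
          (Nat.card (LinCode F r) * Nat.card (LinCode F (n - r))) else 0) ≤
      Nat.card F * (n + 1) ^ 5 * Nat.card (LinCode F n) := by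
    have hterm : ∀ r ∈ Finset.range (n + 1), (if 1 ≤ r ∧ n < 4 * (n - r) then
        (n ^ 2 * Nat.card F) ^ (2 * r) *
          (Nat.card (LinCode F r) * Nat.card (LinCode F (n - r))) else 0) * Q ≤
        (n + 1) ^ 4 * Nat.card (LinCode F n) := by
      intro r hr
      split_ifs with h
      · have hr : r ≤ n := by simp at hr; omega
        refine le_trans ?_ (card_mul_card_mul_le (F := F) hr h.2)
        rw [mul_comm ((n ^ 2 * Nat.card F) ^ (2 * r)), mul_assoc]
        refine Nat.mul_le_mul_left _ ?_
        calc (n ^ 2 * Nat.card F) ^ (2 * r) * Q ≤ Q ^ (2 * r) * Q :=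
              Nat.mul_le_mul_right _ (Nat.pow_le_pow_left hQ _)
          _ = Q ^ (2 * r + 1) := (pow_succ _ _).symm
          -- Here `r ≥ 1` is needed: it is where the scalars must have been excluded.
          _ ≤ Q ^ (4 * r) := Nat.pow_le_pow_right hQ1 (by omega)
      · simp
    rw [Finset.sum_const, smul_eq_mul, Finset.card_univ, ← Nat.card_eq_fintype_card,
      mul_left_comm, mul_comm Q, Finset.sum_mul, Nat.card_units, mul_assoc]
    refine Nat.mul_le_mul (Nat.sub_le _ _) ((Finset.sum_le_card_nsmul _ _ _ hterm).trans_eq ?_)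
    rw [Finset.card_range, smul_eq_mul]
    ring
  calc _ ≤ Q * (_ + _) := Nat.mul_le_mul_left _ h1
    _ ≤ _ := by
      rw [mul_add, add_mul, add_mul]
      exact add_le_add h2 h3

theorem tendsto_numFixedNonscalar_div (F : Type*) [Field F] [Finite F] :
    Tendsto (fun n => (numFixedNonscalar F n : ℝ) / Nat.card (LinCode F n)) atTop (nhds 0) := by
  have hq : 2 ≤ Nat.card F := Finite.one_lt_card
  have hq0 : (0 : ℝ) < Nat.card F := by exact_mod_cast (by omega : 0 < Nat.card F)
  have hlim := (tendsto_pow_div_pow_floor hq 5).const_mul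
    ((Nat.card (F ≃+* F) + Nat.card F : ℕ) : ℝ)
  rw [mul_zero] at hlim
  have hlim2 := (tendsto_pow_div_pow_floor hq 2).const_mul (Nat.card F : ℝ)
  rw [mul_zero] at hlim2
  refine squeeze_zero' (Eventually.of_forall fun n => by positivity) ?_ hlim
  filter_upwards [hlim2.eventually_lt_const one_pos, eventually_ge_atTop 64] with n h1 h2
  have hQ0 : (0 : ℝ) < (Nat.card F : ℝ) ^ (n / 32) := by positivity
  have hQ : n ^ 2 * Nat.card F ≤ Nat.card F ^ (n / 32) := by
    rw [← mul_div_assoc, div_lt_one hQ0] at h1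
    have h3 : (n : ℝ) ^ 2 * Nat.card F ≤ (Nat.card F : ℝ) ^ (n / 32) := by
      refine le_trans ?_ h1.le
      rw [mul_comm]
      gcongr
      linarith
    exact_mod_cast h3
  have key := mul_numFixedNonscalar_le h2 hQ
  have hG : (0 : ℝ) < Nat.card (LinCode F n) := by exact_mod_cast Nat.card_pos
  rw [div_le_iff₀ hG, ← mul_div_assoc, div_mul_eq_mul_div, le_div_iff₀ hQ0]
  rw [mul_comm (numFixedNonscalar F n : ℝ)]
  exact_mod_cast key

theorem isEquivalent_numOrbits (H : ∀ n, Subgroup (SemilinMonomial F n)) (z : ℕ → ℕ)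
    (hz : ∀ n ≠ 0, Nat.card {p // p ∈ H n ∧ p ∈ Set.range (scalar (F := F) n)} = z n)
    (hz0 : ∀ n, 0 < z n) :
    (fun n => (numOrbits (H n) : ℝ)) ~[atTop]
      fun n => (z n : ℝ) * Nat.card (LinCode F n) / Nat.card (H n) := by
  refine isEquivalent_of_mul_le (E := numFixedNonscalar F) (Eventually.of_forall fun n =>
    Nat.card_pos) (Eventually.of_forall hz0) (Eventually.of_forall fun n => Nat.card_pos) ?_ ?_
    (tendsto_numFixedNonscalar_div F)
  · filter_upwards [eventually_ne_atTop 0] with n hn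
    exact hz n hn ▸ (numOrbits_mul_card (H n)).1
  · filter_upwards [eventually_ne_atTop 0] with n hn
    exact hz n hn ▸ (numOrbits_mul_card (H n)).2

end SemilinMonomial

/-! ### The three asymptotic formulas. -/

open SemilinMonomial in
theorem mainTheorem4 {F : Type*} [Field F] [Finite F] (p q a : ℕ)
    (hp : p = ringChar F) (hq : q = Nat.card F) (ha : a = Nat.card (F ≃+* F)) :
    (a : ℝ) = Real.logb p q ∧
    (fun n : ℕ => (numPerm F n : ℝ)) ~[atTop]
      (fun n : ℕ => (1 / (n ! : ℝ)) *
        ∑ π : Equiv.Perm (Fin n) with des π ≤ 1,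
          ((n + 1 - des π).choose n : ℝ) * (q : ℝ) ^ inv π) ∧
    (fun n : ℕ => (numMonomial F n : ℝ)) ~[atTop]
      (fun n : ℕ => (1 / ((n ! : ℝ) * ((q : ℝ) - 1) ^ ((n : ℤ) - 1))) *
        ∑ π : Equiv.Perm (Fin n) with des π ≤ 1,
          ((n + 1 - des π).choose n : ℝ) * (q : ℝ) ^ inv π) ∧
    (fun n : ℕ => (numSemilinear F n : ℝ)) ~[atTop]
      (fun n : ℕ => (1 / ((n ! : ℝ) * ((q : ℝ) - 1) ^ ((n : ℤ) - 1) * (a : ℝ))) *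
        ∑ π : Equiv.Perm (Fin n) with des π ≤ 1,
          ((n + 1 - des π).choose n : ℝ) * (q : ℝ) ^ inv π) := by
  subst hq ha
  have hq : 2 ≤ Nat.card F := Finite.one_lt_card
  have hsum : ∀ n : ℕ, (∑ π : Equiv.Perm (Fin n) with des π ≤ 1,
      ((n + 1 - des π).choose n : ℝ) * (Nat.card F : ℝ) ^ inv π) = Nat.card (LinCode F n) :=
    fun n => by rw [← sum_des_le_one F n]; push_cast; rfl
  simp only [hsum]
  have hq1 : ((Nat.card F : ℝ) - 1) ≠ 0 := by
    have : (2 : ℝ) ≤ Nat.card F := by exact_mod_cast hq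
    linarith
  have hcast : ((Nat.card F - 1 : ℕ) : ℝ) = (Nat.card F : ℝ) - 1 := by
    rw [Nat.cast_sub (by omega), Nat.cast_one]
  have : Finite (F ≃+* F) := Finite.of_injective (fun e : F ≃+* F => (e : F → F))
    DFunLike.coe_injective
  have ha : (Nat.card (F ≃+* F) : ℝ) ≠ 0 := by exact_mod_cast Nat.card_pos.ne'
  refine ⟨card_ringAut_eq_logb p hp, ?_, ?_, ?_⟩
  · simp only [numPerm_eq]
    refine (isEquivalent_numOrbits (fun n => permutations F n) (fun _ => 1)
      (fun _ _ => card_scalar_mem_permutations) fun _ => one_pos).congr_right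
      (Eventually.of_forall fun n => ?_)
    simp only [card_permutations]
    push_cast
    ring
  · simp only [numMonomial_eq]
    refine (isEquivalent_numOrbits (fun n => linear F n) (fun _ => Nat.card F - 1)
      (fun n hn => card_scalar_mem hn _ le_rfl) fun _ => by omega).congr_right
      (Eventually.of_forall fun n => ?_)
    simp only [card_linear]
    -- The `q - 1` scalars turn `(q - 1)^n` from the group order into `(q - 1)^(n-1)`, an integer
    -- power that makes sense for `n = 0` too.
    rw [zpow_sub_one₀ hq1, zpow_natCast]
    push_cast [hcast]
    field_simp
  · simp only [numSemilinear_eq]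
    refine (isEquivalent_numOrbits (fun n => (⊤ : Subgroup (SemilinMonomial F n)))
      (fun _ => Nat.card F - 1)
      (fun n hn => card_scalar_mem hn _ le_top) fun _ => by omega).congr_right
      (Eventually.of_forall fun n => ?_)
    simp only [Subgroup.card_top, card_eq]
    rw [zpow_sub_one₀ hq1, zpow_natCast]
    push_cast [hcast]
    field_simp
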